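/- For a point $u$ in the plane, the six rays from $u$ at angles $j\pi/3$ ($j=0,\dots,5$) from the positive $x$-axis bound six cones with apex $u$. The three \emph{positive cones} of $u$ are $C_i^u$, $i=0,1,2$, the region between the rays at angles $(2i+1)\pi/3$ and $(2i+2)\pi/3$. Let $P$ be a finite set of points in the plane in \emph{general position}, i.e. no two points of $P$ lie on a line parallel to a cone boundary. The \emph{half-$\theta_6$-graph} of $P$ has vertex set $P$; each $u\in P$ is joined, in each of its positive cones that contains a point of $P$, to the point of $P$ in that cone whose orthogonal projection on the bisector of the cone is closest to $u$. Edges have their Euclidean length. For an integer $k\ge 0$, let $N_k(s)$ be the set of vertices that can be reached from $s$ by following at most $k$ edges. A \emph{deterministic $k$-local $0$-memory routing algorithm} is a function $A$ that, from the current vertex $s$, the destination $t$ and the set $N_k(s)$ alone, determines the vertex to which the message is forwarded. Routing from $s$ to $t$ iterates $A$ until the message is at $t$; it succeeds if the message follows edges of the graph and arrives at $t$ after finitely many steps, and the length of the path followed is the sum of the lengths of these edges (it is regarded as infinite if the routing does not succeed). For $w$ in a positive cone of $u$, let $T_{uw}$ be the triangle bounded by that cone and by the line through $w$ perpendicular to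 the bisector of the cone, let $m$ be the midpoint of the side of $T_{uw}$ opposite $u$, and let $\alpha$ be the unsigned angle between $uw$ and $um$. \textbf{Upper bounds.} There is a deterministic $1$-local $0$-memory routing algorithm such that, for every finite point set $P$ in general position and all $u,w\in P$ with $w$ in a positive cone of $u$, the algorithm on the half-$\theta_6$-graph of $P$ succeeds in both directions, and the path followed has length at most \begin{enumerate} \item $\left(\sqrt3\cos\alpha+\sin\alpha\right)|uw|$ when routing from $u$ to $w$, \item $\left(\tfrac{5}{\sqrt3}\cos\alpha-\sin\alpha\right)|uw|$ when routing from $w$ to $u$. \end{enumerate} \textbf{Optimality.} Both bounds are best possible for deterministic $k$-local $0$-memory routing algorithms, for every constant $k$: for every $k$, every such algorithm, and all points $u,w$ with $w$ in the interior of a positive cone of $u$, \begin{enumerate} \item for every real $L<\left(\sqrt3\cos\alpha+\sin\alpha\right)|uw|$ there is a finite point set $P\ni u,w$ in general position such that the path followed on the half-$\theta_6$-graph of $P$ when routing from $u$ to $w$ has length greater than $L$; \item for every real $L<\left(\tfrac{5}{\sqrt3}\cos\alpha-\sin\alpha\right)|uw|$ there is a finite point set $P\ni u,w$ in general position such that the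 path followed on the half-$\theta_6$-graph of $P$ when routing from $w$ to $u$ has length greater than $L$. \end{enumerate} -/

import Mathlib

open scoped RealInnerProductSpace

noncomputable section

namespace HalfThetaSix

/-- The Euclidean plane. -/
abbrev Plane : Type := EuclideanSpace ℝ (Fin 2)

/-- The unit vector at angle `φ` (counter-clockwise) from the positive `x`-axis. -/
def unitVec (φ : ℝ) : Plane := !₂[Real.cos φ, Real.sin φ]

/-- Direction of the `j`-th cone boundary: the ray at angle `j * π / 3`. -/
def ray (j : ℕ) : Plane := unitVec (j * (Real.pi / 3))

/-- The positive cone `C_i` with apex `u`. In counter-clockwise order from the positive `x`-axis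
the six cones are `C̄₁, C₀, C̄₂, C₁, C̄₀, C₂`, so `C_i` is the region between the rays
number `2 * i + 1` and `2 * i + 2`. Points on a cone boundary never occur in a point set in
general position, so the open region is used. -/
def positiveCone (i : Fin 3) (u : Plane) : Set Plane :=
  {v | ∃ a b : ℝ, 0 < a ∧ 0 < b ∧
    v - u = a • ray (2 * (i : ℕ) + 1) + b • ray (2 * (i : ℕ) + 2)}

/-- The unit vector along the bisector of the positive cone `C_i`. -/
def bisector (i : Fin 3) : Plane := unitVec ((2 * (i : ℕ) + 3 / 2) * (Real.pi / 3))

/-- Signed length of the projection of `v - u` onto the bisector of `C_i`. -/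
def coneDist (i : Fin 3) (u v : Plane) : ℝ := ⟪bisector i, v - u⟫

/-- No two points of `P` lie on a line parallel to a cone boundary. -/
def GeneralPosition (P : Finset Plane) : Prop :=
  ∀ u ∈ P, ∀ v ∈ P, u ≠ v → ∀ (j : ℕ) (c : ℝ), v - u ≠ c • ray j

/-- `v` is a vertex of `P` in the positive cone `C_i` of `u` whose projection on the bisector of
that cone is closest to `u`. -/
def IsClosest (P : Finset Plane) (i : Fin 3) (u v : Plane) : Prop :=
  v ∈ P ∧ v ∈ positiveCone i u ∧
    ∀ x ∈ P, x ∈ positiveCone i u → coneDist i u v ≤ coneDist i u x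

/-- The half-`θ₆`-graph of `P`, as a graph on the plane whose edges all join points of `P`: every
`u ∈ P` is joined to the closest vertex in each of its positive cones. -/
def halfTheta6 (P : Finset Plane) : SimpleGraph Plane where
  Adj u v := u ≠ v ∧ u ∈ P ∧ v ∈ P ∧ ∃ i : Fin 3, IsClosest P i u v ∨ IsClosest P i v u
  symm := ⟨fun _ _ ⟨hne, hu, hv, i, h⟩ => ⟨hne.symm, hv, hu, i, h.symm⟩⟩
  loopless := ⟨fun _ h => h.1 rfl⟩

/-- The `k`-neighbourhood `N_k(s)`: the vertices that can be reached from `s` by following at most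
`k` edges of the half-`θ₆`-graph of `P`. -/
def kNeighborhood (P : Finset Plane) (k : ℕ) (s : Plane) : Set Plane :=
  {v | ∃ p : (halfTheta6 P).Walk s v, p.length ≤ k}

/-- The decision function of a deterministic local 0-memory routing algorithm: from the current
vertex `s`, the destination `t` and the set of vertices seen from `s`, it determines the vertex to
which the message is forwarded. It is used as a `k`-local algorithm by feeding it `N_k(s)`. -/
abbrev RoutingAlgorithm : Type := Plane → Plane → Set Plane → Plane

/-- The vertex that holds the message after `n` steps, when the algorithm `A`, used as a `k`-local
algorithm on the half-`θ₆`-graph of `P`, routes from `s` to `t`. -/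
def position (A : RoutingAlgorithm) (k : ℕ) (P : Finset Plane) (s t : Plane) : ℕ → Plane
  | 0 => s
  | n + 1 => A (position A k P s t n) t (kNeighborhood P k (position A k P s t n))

/-- When routing from `s` to `t`, the message follows edges of the graph and arrives at `t` for the
first time after exactly `n` steps. -/
def ArrivesAfter (A : RoutingAlgorithm) (k : ℕ) (P : Finset Plane) (s t : Plane) (n : ℕ) : Prop :=
  position A k P s t n = t ∧
    ∀ j < n, position A k P s t j ≠ t ∧
      (halfTheta6 P).Adj (position A k P s t j) (position A k P s t (j + 1))

/-- The distance travelled by the message during the first `n` steps. -/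
def travelled (A : RoutingAlgorithm) (k : ℕ) (P : Finset Plane) (s t : Plane) (n : ℕ) : ℝ :=
  ∑ j ∈ Finset.range n, dist (position A k P s t j) (position A k P s t (j + 1))

/-- For `w` in the positive cone `C_i` of `u`, the corner on the boundary ray number `j`
(`j = 2 * i + 1` or `j = 2 * i + 2`) of the canonical triangle `T_{uw}`, which is bounded by the cone
and the line through `w` perpendicular to its bisector: it is the point of that ray whose
projection on the bisector agrees with that of `w`. -/
def canonicalCorner (i : Fin 3) (j : ℕ) (u w : Plane) : Plane :=
  u + (coneDist i u w / ⟪bisector i, ray j⟫) • ray j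

/-- The midpoint `m` of the side of the canonical triangle `T_{uw}` opposing `u`. -/
def oppositeMidpoint (i : Fin 3) (u w : Plane) : Plane :=
  midpoint ℝ (canonicalCorner i (2 * (i : ℕ) + 1) u w) (canonicalCorner i (2 * (i : ℕ) + 2) u w)

/-- The unsigned angle `α` between `uw` and `um`. -/
def canonicalAngle (i : Fin 3) (u w : Plane) : ℝ :=
  EuclideanGeometry.angle w u (oppositeMidpoint i u w)

/-- `(√3 cos α + sin α) |uw|`. -/
def positiveBound (i : Fin 3) (u w : Plane) : ℝ :=
  (√3 * Real.cos (canonicalAngle i u w) + Real.sin (canonicalAngle i u w)) * dist u w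

/-- `(5/√3 cos α - sin α) |uw|`. -/
def negativeBound (i : Fin 3) (u w : Plane) : ℝ :=
  (5 / √3 * Real.cos (canonicalAngle i u w) - Real.sin (canonicalAngle i u w)) * dist u w

end HalfThetaSix

end

open HalfThetaSix

/-!
The three scaled projections `coord i` on the bisectors of the positive cones have sum zero, and a
point is in `C_i` of another one if and only if its other two coordinates are smaller. For `w` in
`C_i` of `u` put `D = coord i w - coord i u` and `d l = coord l u - coord l w`. In these
coordinates the bounds are `D + max (d j) (d k)` and `2 * D + min (d j) (d k)`, where `j` and `k`
are the indices other than `i`.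

For the upper bounds, the router moves to the closest vertex when the destination `t` is in a
positive cone of the current vertex `s`. When `s` is in `C_i` of `t`, the router moves into the
canonical triangle of `t` and `s`, or into one of the two regions where the other two positive
cones of `s` meet `C_i` of `t`. As soon as one of these regions is empty, it keeps to the other
side, and its choices keep such a region empty, so that no memory is needed. A bound on the
remaining length drops in every step by at least the length of the edge.

For the lower bound from `u` to `w`, a third point near a corner of the canonical triangle is the
only neighbour of `u`. For the lower bound from `w` to `u`, the points zigzag between the two sides
of the triangle while they descend from `w`, so that the last point is the only neighbour of `u`.
The `k`-neighbourhood of `w` is the same for an even and for an odd number of points, if there are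
enough of them, so the adversary can place the last point on the side opposite to the first move.
-/

namespace HalfThetaSix

/-! ### Triangular coordinates -/

section Distinct

/-- `i`, `j`, `k` are the three cone indices in some order. A statement about the cone `C_i` and its
two sides is proved for every such triple, which covers its mirror image as well. -/
abbrev Distinct (i j k : Fin 3) : Prop := i ≠ j ∧ i ≠ k ∧ j ≠ k

variable {i j k : Fin 3}

lemma Distinct.swap (h : Distinct i j k) : Distinct i k j :=
  ⟨h.2.1, h.1, h.2.2.symm⟩

lemma Distinct.rotate (h : Distinct i j k) : Distinct j k i :=
  ⟨h.2.2, h.1.symm, h.2.1.symm⟩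

lemma distinct_add (i : Fin 3) : Distinct i (i + 1) (i + 2) := by
  revert i; decide

lemma Distinct.eq_or (h : Distinct i j k) (l : Fin 3) : l = i ∨ l = j ∨ l = k := by
  revert i j k l; decide

lemma Distinct.eq_or_swap {j' k' : Fin 3} (h : Distinct i j k) (h' : Distinct i j' k') :
    (j' = j ∧ k' = k) ∨ (j' = k ∧ k' = j) := by
  revert i j k j' k'; decide

lemma exists_distinct_le {α : Type*} [LinearOrder α] (i : Fin 3) (f : Fin 3 → α) :
    ∃ j k, Distinct i j k ∧ f j ≤ f k := by
  rcases le_total (f (i + 1)) (f (i + 2)) with hle | hle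
  · exact ⟨_, _, distinct_add i, hle⟩
  · exact ⟨_, _, (distinct_add i).swap, hle⟩

lemma Distinct.sum_eq {M : Type*} [AddCommMonoid M] (h : Distinct i j k) (f : Fin 3 → M) :
    ∑ l, f l = f i + f j + f k := by
  have huniv : (Finset.univ : Finset (Fin 3)) = {i, j, k} := by revert i j k; decide
  rw [huniv, Finset.sum_insert (by simp [h.1, h.2.1]), Finset.sum_pair h.2.2, add_assoc]

end Distinct

lemma inner_unitVec (φ : ℝ) (p : Plane) :
    ⟪unitVec φ, p⟫ = Real.cos φ * p 0 + Real.sin φ * p 1 := by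
  simp [unitVec, PiLp.inner_apply, Fin.sum_univ_two, mul_comm]

lemma inner_unitVec_unitVec (φ ψ : ℝ) : ⟪unitVec φ, unitVec ψ⟫ = Real.cos (φ - ψ) := by
  rw [inner_unitVec, Real.cos_sub]
  simp [unitVec]

lemma unitVec_sub_add_unitVec_add (φ δ : ℝ) :
    unitVec (φ - δ) + unitVec (φ + δ) = (2 * Real.cos δ) • unitVec φ := by
  ext l
  fin_cases l
  · change Real.cos (φ - δ) + Real.cos (φ + δ) = 2 * Real.cos δ * Real.cos φ
    rw [Real.cos_sub, Real.cos_add]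
    ring
  · change Real.sin (φ - δ) + Real.sin (φ + δ) = 2 * Real.cos δ * Real.sin φ
    rw [Real.sin_sub, Real.sin_add]
    ring

/-- The `i`-th triangular coordinate: the projection on the bisector of the cone `C_i`, scaled so
that the side of a canonical triangle is a difference of coordinates. -/
noncomputable def coord (i : Fin 3) : Plane →ₗ[ℝ] ℝ := (2 / √3) • innerₗ Plane (bisector i)

lemma coord_apply (i : Fin 3) (p : Plane) : coord i p = 2 / √3 * ⟪bisector i, p⟫ := rfl

lemma inner_bisector (i : Fin 3) (p : Plane) : ⟪bisector i, p⟫ = √3 / 2 * coord i p := by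
  rw [coord_apply]
  field_simp

lemma coneDist_eq (i : Fin 3) (u v : Plane) :
    coneDist i u v = √3 / 2 * (coord i v - coord i u) := by
  rw [coneDist, inner_bisector, map_sub]

lemma coneDist_le_coneDist_iff {i : Fin 3} {u v x : Plane} :
    coneDist i u v ≤ coneDist i u x ↔ coord i v ≤ coord i x := by
  rw [coneDist_eq, coneDist_eq, mul_le_mul_iff_right₀ (by positivity), sub_le_sub_iff_right]

lemma two_div_sqrt_three : 2 / √3 = 2 * √3 / 3 := by
  rw [mul_div_assoc, Real.sqrt_div_self, div_eq_mul_one_div]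
  simp

lemma coord_zero (p : Plane) : coord 0 p = 2 * √3 / 3 * p 1 := by
  have hb : bisector 0 = unitVec (Real.pi / 2) := by
    simp only [bisector, Fin.val_zero]; congr 1; push_cast; ring
  rw [coord_apply, hb, inner_unitVec, Real.cos_pi_div_two, Real.sin_pi_div_two, two_div_sqrt_three]
  ring

lemma coord_one (p : Plane) : coord 1 p = -p 0 - √3 / 3 * p 1 := by
  have hb : bisector 1 = unitVec (Real.pi / 6 + Real.pi) := by
    simp only [bisector, Fin.val_one]; congr 1; push_cast; ring
  rw [coord_apply, hb, inner_unitVec, Real.cos_add_pi, Real.sin_add_pi, Real.cos_pi_div_six,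
    Real.sin_pi_div_six, two_div_sqrt_three]
  linear_combination (-p 0 / 3) * Real.mul_self_sqrt (show (0 : ℝ) ≤ 3 by norm_num)

lemma coord_two (p : Plane) : coord 2 p = p 0 - √3 / 3 * p 1 := by
  have hb : bisector 2 = unitVec (-(Real.pi / 6) + 2 * Real.pi) := by
    simp only [bisector, Fin.val_two]; congr 1; push_cast; ring
  rw [coord_apply, hb, inner_unitVec, Real.cos_add_two_pi, Real.sin_add_two_pi, Real.cos_neg,
    Real.sin_neg, Real.cos_pi_div_six, Real.sin_pi_div_six, two_div_sqrt_three]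
  linear_combination (p 0 / 3) * Real.mul_self_sqrt (show (0 : ℝ) ≤ 3 by norm_num)

lemma sum_coord (p : Plane) : ∑ l, coord l p = 0 := by
  rw [Fin.sum_univ_three, coord_zero, coord_one, coord_two]
  ring

lemma exists_coord_eq {f : Fin 3 → ℝ} (hf : ∑ l, f l = 0) : ∃ p : Plane, ∀ l, coord l p = f l := by
  have h3 : √3 * √3 = 3 := Real.mul_self_sqrt (by norm_num)
  rw [Fin.sum_univ_three] at hf
  refine ⟨!₂[(f 2 - f 1) / 2, √3 / 2 * f 0], fun l => ?_⟩
  fin_cases l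
  · refine (coord_zero _).trans ?_
    change 2 * √3 / 3 * (√3 / 2 * f 0) = f 0
    linear_combination (f 0 / 3) * h3
  · refine (coord_one _).trans ?_
    change -((f 2 - f 1) / 2) - √3 / 3 * (√3 / 2 * f 0) = f 1
    linear_combination (-f 0 / 6) * h3 - hf / 2
  · refine (coord_two _).trans ?_
    change (f 2 - f 1) / 2 - √3 / 3 * (√3 / 2 * f 0) = f 2
    linear_combination (-f 0 / 6) * h3 - hf / 2

lemma dist_sq_eq_sum (p q : Plane) : dist p q ^ 2 = (∑ l, (coord l p - coord l q) ^ 2) / 2 := by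
  rw [EuclideanSpace.dist_eq, Real.sq_sqrt (by positivity), Fin.sum_univ_two, Fin.sum_univ_three,
    Real.dist_eq, Real.dist_eq, sq_abs, sq_abs]
  simp only [coord_zero, coord_one, coord_two]
  linear_combination (-(p 1 - q 1) ^ 2 / 3) * Real.mul_self_sqrt (show (0 : ℝ) ≤ 3 by norm_num)

section Frame

variable {i j k : Fin 3} (h : Distinct i j k)
include h

lemma coord_add_add_eq_zero (p : Plane) : coord i p + coord j p + coord k p = 0 := by
  rw [← h.sum_eq fun l => coord l p, sum_coord]

lemma exists_coord_eq_and_eq (x y : ℝ) : ∃ p : Plane, coord i p = x ∧ coord j p = y := by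
  obtain ⟨p, hp⟩ := exists_coord_eq (f := fun l => if l = i then x else if l = j then y else -x - y)
    (by simp [h.sum_eq, h.1.symm, h.2.1.symm, h.2.2.symm])
  exact ⟨p, by simp [hp], by simp [hp, h.1.symm]⟩

lemma dist_sq_eq (p q : Plane) :
    dist p q ^ 2 = ((coord i p - coord i q) ^ 2 + (coord j p - coord j q) ^ 2
      + (coord k p - coord k q) ^ 2) / 2 := by
  rw [dist_sq_eq_sum, h.sum_eq]

lemma eq_of_coord_eq {p q : Plane} (hi : coord i p = coord i q) (hj : coord j p = coord j q) :
    p = q := by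
  have hk : coord k p = coord k q := by
    linarith [coord_add_add_eq_zero h p, coord_add_add_eq_zero h q]
  simpa [hi, hj, hk] using dist_sq_eq h p q

/-- Half of the left-hand side is the signed length of the projection of `p - q` on the lines where
`coord i` is constant. -/
lemma coord_sub_coord_le_two_mul_dist (p q : Plane) :
    (coord j p - coord j q) - (coord k p - coord k q) ≤ 2 * dist p q := by
  refine le_of_abs_le (abs_le_of_sq_le_sq ?_ (by positivity))
  have hp := coord_add_add_eq_zero h p
  have hq := coord_add_add_eq_zero h q
  have hi : coord i p - coord i q = -(coord j p - coord j q) - (coord k p - coord k q) := by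
    linarith
  rw [mul_pow, dist_sq_eq h, hi]
  nlinarith [sq_nonneg (coord j p - coord j q + (coord k p - coord k q))]

end Frame

/-! ### Cones and general position -/

lemma coord_ray (i : Fin 3) (j : ℕ) :
    coord i (ray j) = 2 / √3 * Real.cos ((2 * (i : ℕ) + 3 / 2 - j) * (Real.pi / 3)) := by
  rw [coord_apply, bisector, ray, inner_unitVec_unitVec, sub_mul]

lemma coord_ray_left (i : Fin 3) : coord i (ray (2 * i + 1)) = 1 := by
  have hangle : (2 * (i : ℕ) + 3 / 2 - (2 * i + 1 : ℕ)) * (Real.pi / 3) = Real.pi / 6 := by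
    push_cast; ring
  rw [coord_ray, hangle, Real.cos_pi_div_six]
  field_simp

lemma coord_ray_right (i : Fin 3) : coord i (ray (2 * i + 2)) = 1 := by
  have hangle : (2 * (i : ℕ) + 3 / 2 - (2 * i + 2 : ℕ)) * (Real.pi / 3) = -(Real.pi / 6) := by
    push_cast; ring
  rw [coord_ray, hangle, Real.cos_neg, Real.cos_pi_div_six]
  field_simp

lemma coord_ray_eq_zero {i : Fin 3} {j : ℕ} (h : (3 : ℤ) ∣ 2 * (i : ℕ) - j) :
    coord i (ray j) = 0 := by
  obtain ⟨m, hm⟩ := h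
  have hm' : (2 * (i : ℕ) : ℝ) - j = 3 * m := by exact_mod_cast hm
  have hangle : (2 * (i : ℕ) + 3 / 2 - j) * (Real.pi / 3) = Real.pi / 2 + m * Real.pi := by
    linear_combination (Real.pi / 3) * hm'
  rw [coord_ray, hangle, Real.cos_add_int_mul_pi, Real.cos_pi_div_two]
  simp

lemma coord_add_two_ray_left (i : Fin 3) : coord (i + 2) (ray (2 * i + 1)) = 0 :=
  coord_ray_eq_zero (by revert i; decide)

lemma coord_add_one_ray_right (i : Fin 3) : coord (i + 1) (ray (2 * i + 2)) = 0 :=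
  coord_ray_eq_zero (by revert i; decide)

lemma coord_add_one_ray_left (i : Fin 3) : coord (i + 1) (ray (2 * i + 1)) = -1 := by
  linarith [coord_add_add_eq_zero (distinct_add i) (ray (2 * i + 1)), coord_ray_left i,
    coord_add_two_ray_left i]

lemma coord_add_two_ray_right (i : Fin 3) : coord (i + 2) (ray (2 * i + 2)) = -1 := by
  linarith [coord_add_add_eq_zero (distinct_add i) (ray (2 * i + 2)), coord_ray_right i,
    coord_add_one_ray_right i]

lemma exists_sub_eq_smul_ray_iff {u v : Plane} :
    (∃ (j : ℕ) (c : ℝ), v - u = c • ray j) ↔ ∃ i, coord i v = coord i u := by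
  constructor
  · rintro ⟨j, c, hc⟩
    obtain ⟨i, hi⟩ : ∃ i : Fin 3, (3 : ℤ) ∣ 2 * (i : ℕ) - j := by
      obtain ⟨i, hi⟩ : ∃ i : Fin 3, (i : ℕ) = 2 * j % 3 := ⟨⟨2 * j % 3, by omega⟩, rfl⟩
      exact ⟨i, by omega⟩
    refine ⟨i, ?_⟩
    rw [← sub_eq_zero, ← map_sub, hc, map_smul, coord_ray_eq_zero hi, smul_zero]
  · rintro ⟨i, hi⟩
    have hr := coord_add_one_ray_right (i + 2)
    have hs := coord_add_two_ray_right (i + 2)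
    rw [show i + 2 + 1 = i by grind] at hr
    rw [show i + 2 + 2 = i + 1 by grind] at hs
    exact ⟨2 * (i + 2 : Fin 3) + 2, coord (i + 1) u - coord (i + 1) v,
      eq_of_coord_eq (distinct_add i) (by simp [hr, hi]) (by simp [hs])⟩

lemma mem_positiveCone {i j k : Fin 3} (h : Distinct i j k) {u v : Plane} :
    v ∈ positiveCone i u ↔ coord j v < coord j u ∧ coord k v < coord k u := by
  suffices hadd : v ∈ positiveCone i u ↔
      coord (i + 1) v < coord (i + 1) u ∧ coord (i + 2) v < coord (i + 2) u by
    rcases (distinct_add i).eq_or_swap h with ⟨rfl, rfl⟩ | ⟨rfl, rfl⟩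
    · exact hadd
    · exact hadd.trans and_comm
  have hcomb (a b : ℝ) : coord (i + 1) (a • ray (2 * i + 1) + b • ray (2 * i + 2)) = -a ∧
      coord (i + 2) (a • ray (2 * i + 1) + b • ray (2 * i + 2)) = -b := by
    simp [coord_add_one_ray_left, coord_add_two_ray_left, coord_add_one_ray_right,
      coord_add_two_ray_right]
  constructor
  · rintro ⟨a, b, ha, hb, hv⟩
    have hab := hcomb a b
    rw [← hv, map_sub, map_sub] at hab
    constructor <;> linarith [hab.1, hab.2]
  · rintro ⟨h1, h2⟩
    refine ⟨coord (i + 1) u - coord (i + 1) v, coord (i + 2) u - coord (i + 2) v, by linarith,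
      by linarith, eq_of_coord_eq (distinct_add i).rotate ?_ ?_⟩
    · rw [(hcomb _ _).1, map_sub]; ring
    · rw [(hcomb _ _).2, map_sub]; ring

section PositiveCone

variable {i l : Fin 3} {s t u v w : Plane}

lemma coord_lt_of_mem_positiveCone_of_ne (hv : v ∈ positiveCone i u) (hl : l ≠ i) :
    coord l v < coord l u := by
  obtain ⟨m, hm⟩ : ∃ m, Distinct i l m := by clear hv; revert i l; decide
  exact ((mem_positiveCone hm).1 hv).1

lemma coord_lt_of_mem_positiveCone (hv : v ∈ positiveCone i u) : coord i u < coord i v := by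
  have h := (mem_positiveCone (distinct_add i)).1 hv
  linarith [coord_add_add_eq_zero (distinct_add i) u, coord_add_add_eq_zero (distinct_add i) v]

lemma coord_ne_of_mem_positiveCone (hv : v ∈ positiveCone i u) (l : Fin 3) :
    coord l v ≠ coord l u := by
  obtain rfl | hl := eq_or_ne l i
  · exact (coord_lt_of_mem_positiveCone hv).ne'
  · exact (coord_lt_of_mem_positiveCone_of_ne hv hl).ne

lemma ne_of_mem_positiveCone (hv : v ∈ positiveCone i u) : v ≠ u := by
  rintro rfl
  exact coord_ne_of_mem_positiveCone hv i rfl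

lemma eq_of_mem_positiveCone (hi : v ∈ positiveCone i u) (hl : v ∈ positiveCone l u) : i = l := by
  by_contra hne
  exact (coord_lt_of_mem_positiveCone_of_ne hl hne).not_gt (coord_lt_of_mem_positiveCone hi)

lemma not_mem_positiveCone_of_mem (h : v ∈ positiveCone i u) : u ∉ positiveCone l v := by
  obtain ⟨m, hi, hl⟩ : ∃ m, m ≠ i ∧ m ≠ l := by clear h; revert i l; decide
  exact fun h' => (coord_lt_of_mem_positiveCone_of_ne h' hl).not_gt
    (coord_lt_of_mem_positiveCone_of_ne h hi)

lemma positiveCone_trans (hv : v ∈ positiveCone i u) (hw : w ∈ positiveCone i v) :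
    w ∈ positiveCone i u := by
  rw [mem_positiveCone (distinct_add i)] at hv hw ⊢
  exact ⟨hw.1.trans hv.1, hw.2.trans hv.2⟩

/-- The right-hand side is the length of the path that first follows one boundary direction of the
cone and then the other. -/
lemma dist_le_of_mem_positiveCone (hv : v ∈ positiveCone i u) :
    dist u v ≤ coord i v - coord i u := by
  have h := distinct_add i
  have hu := coord_add_add_eq_zero h u
  have hv' := coord_add_add_eq_zero h v
  obtain ⟨h1, h2⟩ := (mem_positiveCone h).1 hv
  have hi : coord i v - coord i u
      = (coord (i + 1) u - coord (i + 1) v) + (coord (i + 2) u - coord (i + 2) v) := by linarith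
  refine le_of_abs_le (abs_le_of_sq_le_sq ?_ (sub_nonneg.2 (coord_lt_of_mem_positiveCone hv).le))
  rw [dist_sq_eq h, ← neg_sq (coord i u - coord i v), neg_sub, hi]
  nlinarith [mul_pos (sub_pos.2 h1) (sub_pos.2 h2)]

lemma forall_coord_ne_iff_exists_mem_positiveCone :
    (∀ l, coord l v ≠ coord l u) ↔ ∃ i, v ∈ positiveCone i u ∨ u ∈ positiveCone i v := by
  constructor
  · intro hne
    have h : Distinct 0 1 2 := by decide
    have hu := coord_add_add_eq_zero h u
    have hv := coord_add_add_eq_zero h v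
    rcases lt_or_gt_of_ne (hne 0) with h0 | h0 <;> rcases lt_or_gt_of_ne (hne 1) with h1 | h1 <;>
      rcases lt_or_gt_of_ne (hne 2) with h2 | h2
    · linarith
    · exact ⟨2, .inl ((mem_positiveCone h.rotate.rotate).2 ⟨h0, h1⟩)⟩
    · exact ⟨1, .inl ((mem_positiveCone h.rotate).2 ⟨h2, h0⟩)⟩
    · exact ⟨0, .inr ((mem_positiveCone h).2 ⟨h1, h2⟩)⟩
    · exact ⟨0, .inl ((mem_positiveCone h).2 ⟨h1, h2⟩)⟩
    · exact ⟨1, .inr ((mem_positiveCone h.rotate).2 ⟨h2, h0⟩)⟩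
    · exact ⟨2, .inr ((mem_positiveCone h.rotate.rotate).2 ⟨h0, h1⟩)⟩
    · linarith
  · rintro ⟨i, hv | hu⟩ l
    · exact coord_ne_of_mem_positiveCone hv l
    · exact (coord_ne_of_mem_positiveCone hu l).symm

end PositiveCone

lemma generalPosition_iff_pairwise {P : Finset Plane} : GeneralPosition P ↔
    (P : Set Plane).Pairwise fun u v => ∃ i, v ∈ positiveCone i u ∨ u ∈ positiveCone i v := by
  have hgeneric (u v : Plane) : (∀ (j : ℕ) (c : ℝ), v - u ≠ c • ray j) ↔
      ∃ i, v ∈ positiveCone i u ∨ u ∈ positiveCone i v := by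
    rw [← forall_coord_ne_iff_exists_mem_positiveCone]
    simpa using not_congr (exists_sub_eq_smul_ray_iff (u := u) (v := v))
  simp only [GeneralPosition, hgeneric]
  rfl

lemma GeneralPosition.coord_ne {P : Finset Plane} (hP : GeneralPosition P) {u v : Plane}
    (hu : u ∈ P) (hv : v ∈ P) (hne : u ≠ v) (l : Fin 3) : coord l u ≠ coord l v :=
  forall_coord_ne_iff_exists_mem_positiveCone.2
    (generalPosition_iff_pairwise.1 hP hv hu hne.symm) l

/-! ### The bounds in coordinates -/

lemma norm_bisector (i : Fin 3) : ‖bisector i‖ = 1 := by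
  rw [← sq_eq_sq₀ (norm_nonneg _) zero_le_one, ← real_inner_self_eq_norm_sq, bisector,
    inner_unitVec_unitVec]
  simp

lemma ray_add_ray (i : Fin 3) : ray (2 * i + 1) + ray (2 * i + 2) = √3 • bisector i := by
  have hleft : ((2 * i + 1 : ℕ) : ℝ) * (Real.pi / 3)
      = (2 * (i : ℕ) + 3 / 2) * (Real.pi / 3) - Real.pi / 6 := by push_cast; ring
  have hright : ((2 * i + 2 : ℕ) : ℝ) * (Real.pi / 3)
      = (2 * (i : ℕ) + 3 / 2) * (Real.pi / 3) + Real.pi / 6 := by push_cast; ring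
  rw [ray, ray, hleft, hright, unitVec_sub_add_unitVec_add, Real.cos_pi_div_six, bisector,
    mul_div_cancel₀ _ two_ne_zero]

lemma oppositeMidpoint_eq (i : Fin 3) (u w : Plane) :
    oppositeMidpoint i u w = u + coneDist i u w • bisector i := by
  rw [oppositeMidpoint, canonicalCorner, canonicalCorner, inner_bisector, inner_bisector,
    coord_ray_left, coord_ray_right, mul_one]
  refine (midpoint_vadd_midpoint u u _ _).symm.trans ?_
  rw [midpoint_self, midpoint_eq_smul_add, ← smul_add, ray_add_ray, invOf_eq_inv, smul_smul,
    smul_smul, vadd_eq_add]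
  congr 2
  field_simp

section Bounds

variable {i j k : Fin 3} {u w : Plane}

lemma canonicalAngle_eq (hw : w ∈ positiveCone i u) :
    canonicalAngle i u w = InnerProductGeometry.angle (w - u) (bisector i) := by
  have hpos : 0 < coneDist i u w := by
    rw [coneDist_eq]
    exact mul_pos (by positivity) (sub_pos.2 (coord_lt_of_mem_positiveCone hw))
  rw [canonicalAngle, EuclideanGeometry.angle, oppositeMidpoint_eq, vsub_eq_sub, vsub_eq_sub,
    add_sub_cancel_left, InnerProductGeometry.angle_smul_right_of_pos _ _ hpos]

lemma cos_canonicalAngle_mul_dist (hw : w ∈ positiveCone i u) :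
    Real.cos (canonicalAngle i u w) * dist u w = √3 / 2 * (coord i w - coord i u) := by
  have hcos := InnerProductGeometry.cos_angle_mul_norm_mul_norm (w - u) (bisector i)
  rwa [norm_bisector, mul_one, real_inner_comm, inner_bisector, map_sub, ← canonicalAngle_eq hw,
    ← dist_eq_norm, dist_comm] at hcos

lemma sin_canonicalAngle_mul_dist (h : Distinct i j k) (hw : w ∈ positiveCone i u) :
    Real.sin (canonicalAngle i u w) * dist u w
      = |(coord j u - coord j w) - (coord k u - coord k w)| / 2 := by
  have hcos := cos_canonicalAngle_mul_dist hw
  have hsin := Real.sin_sq_add_cos_sq (canonicalAngle i u w)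
  have hu := coord_add_add_eq_zero h u
  have hw' := coord_add_add_eq_zero h w
  have hi : coord i w - coord i u = (coord j u - coord j w) + (coord k u - coord k w) := by linarith
  have h3 : √3 ^ 2 = 3 := Real.sq_sqrt (by norm_num)
  have hsin_nonneg : 0 ≤ Real.sin (canonicalAngle i u w) :=
    InnerProductGeometry.sin_angle_nonneg _ _
  rw [← sq_eq_sq₀ (mul_nonneg hsin_nonneg dist_nonneg) (by positivity), div_pow, sq_abs,
    mul_pow]
  have hdist := dist_sq_eq h u w
  have hcos_sq := congrArg (· ^ 2) hcos
  simp only [mul_pow, div_pow, h3, hi] at hcos_sq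
  rw [← neg_sq (coord i u - coord i w), neg_sub, hi] at hdist
  linear_combination dist u w ^ 2 * hsin + hdist - hcos_sq

lemma positiveBound_eq (h : Distinct i j k) (hw : w ∈ positiveCone i u) :
    positiveBound i u w
      = (coord i w - coord i u) + max (coord j u - coord j w) (coord k u - coord k w) := by
  have h3 : √3 ^ 2 = 3 := Real.sq_sqrt (by norm_num)
  rw [positiveBound, add_mul, mul_assoc, cos_canonicalAngle_mul_dist hw,
    sin_canonicalAngle_mul_dist h hw, max_comm,
    sup_eq_half_smul_add_add_abs_sub' ℝ, smul_eq_mul]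
  linear_combination (coord i w - coord i u) / 2 * h3
    + (coord_add_add_eq_zero h w - coord_add_add_eq_zero h u) / 2

lemma negativeBound_eq (h : Distinct i j k) (hw : w ∈ positiveCone i u) :
    negativeBound i u w
      = 2 * (coord i w - coord i u) + min (coord j u - coord j w) (coord k u - coord k w) := by
  rw [negativeBound, sub_mul, mul_assoc, cos_canonicalAngle_mul_dist hw,
    sin_canonicalAngle_mul_dist h hw, min_comm,
    inf_eq_half_smul_add_sub_abs_sub' ℝ, smul_eq_mul]
  field_simp
  linear_combination coord_add_add_eq_zero h w - coord_add_add_eq_zero h u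

end Bounds

/-! ### Neighbourhoods and routes -/

section Graph

variable {P P' : Finset Plane} {i : Fin 3} {k : ℕ} {s u v x : Plane}

lemma exists_isClosest (hx : x ∈ P) (hxs : x ∈ positiveCone i s) : ∃ v, IsClosest P i s v := by
  obtain ⟨v, hv, hmin⟩ := ((P : Set Plane) ∩ positiveCone i s).exists_min_image (coneDist i s)
    (P.finite_toSet.inter_of_left _) ⟨x, hx, hxs⟩
  exact ⟨v, hv.1, hv.2, fun y hy hys => hmin y ⟨hy, hys⟩⟩

lemma IsClosest.coord_le (h : IsClosest P i s v) (hx : x ∈ P) (hxs : x ∈ positiveCone i s) :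
    coord i v ≤ coord i x :=
  coneDist_le_coneDist_iff.1 (h.2.2 x hx hxs)

lemma adj_iff_isClosest (hv : v ∈ positiveCone i s) :
    (halfTheta6 P).Adj s v ↔ s ∈ P ∧ IsClosest P i s v := by
  constructor
  · rintro ⟨-, hs, -, l, h | h⟩
    · rw [eq_of_mem_positiveCone hv h.2.1]
      exact ⟨hs, h⟩
    · exact absurd h.2.1 (not_mem_positiveCone_of_mem hv)
  · rintro ⟨hs, h⟩
    exact ⟨(ne_of_mem_positiveCone hv).symm, hs, h.1, i, .inl h⟩

lemma mem_kNeighborhood_self : s ∈ kNeighborhood P k s :=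
  ⟨.nil, by simp⟩

lemma kNeighborhood_zero (P : Finset Plane) (s : Plane) : kNeighborhood P 0 s = {s} := by
  ext v
  constructor
  · rintro ⟨p, hp⟩
    exact (SimpleGraph.Walk.eq_of_length_eq_zero (Nat.le_zero.1 hp)).symm
  · rintro rfl
    exact mem_kNeighborhood_self

lemma mem_kNeighborhood_succ : v ∈ kNeighborhood P (k + 1) s ↔
    v ∈ kNeighborhood P k s ∨ ∃ x ∈ kNeighborhood P k s, (halfTheta6 P).Adj x v := by
  constructor
  · rintro ⟨p, hp⟩
    cases p using SimpleGraph.Walk.concatRec with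
    | Hnil => exact .inl mem_kNeighborhood_self
    | Hconcat p hadj => exact .inr ⟨_, ⟨p, by simpa using hp⟩, hadj⟩
  · rintro (⟨p, hp⟩ | ⟨x, ⟨p, hp⟩, hadj⟩)
    · exact ⟨p, by lia⟩
    · exact ⟨p.concat hadj, by simpa using hp⟩

lemma mem_kNeighborhood_one : v ∈ kNeighborhood P 1 s ↔ v = s ∨ (halfTheta6 P).Adj s v := by
  simp [mem_kNeighborhood_succ, kNeighborhood_zero]

lemma mem_of_mem_kNeighborhood (hs : s ∈ P) (h : v ∈ kNeighborhood P k s) : v ∈ P := by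
  obtain ⟨p, -⟩ := h
  induction p with
  | nil => exact hs
  | cons hadj _ ih => exact ih hadj.2.2.1

lemma finite_kNeighborhood (hs : s ∈ P) : (kNeighborhood P k s).Finite :=
  P.finite_toSet.subset fun _ => mem_of_mem_kNeighborhood hs

lemma kNeighborhood_subset_of_adj (h : ∀ x ∈ kNeighborhood P k s, ∀ y ∈ kNeighborhood P k s,
    (halfTheta6 P).Adj x y → (halfTheta6 P').Adj x y) :
    kNeighborhood P k s ⊆ kNeighborhood P' k s := by
  induction k with
  | zero => simp [kNeighborhood_zero]
  | succ k ih =>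
    have hmono : kNeighborhood P k s ⊆ kNeighborhood P (k + 1) s :=
      fun x hx => mem_kNeighborhood_succ.2 (.inl hx)
    have hsub := ih fun x hx y hy => h x (hmono hx) y (hmono hy)
    intro v hv
    rcases mem_kNeighborhood_succ.1 hv with hvk | ⟨x, hx, hadj⟩
    · exact mem_kNeighborhood_succ.2 (.inl (hsub hvk))
    · exact mem_kNeighborhood_succ.2 (.inr ⟨x, hsub hx, h x (hmono hx) v hv hadj⟩)

end Graph

section Route

variable {A : RoutingAlgorithm} {k : ℕ} {P : Finset Plane} {s t : Plane} {n : ℕ}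

lemma position_succ : position A k P s t (n + 1)
    = position A k P (A s t (kNeighborhood P k s)) t n := by
  induction n with
  | zero => rfl
  | succ n ih => rw [position, ih]; rfl

lemma travelled_succ : travelled A k P s t (n + 1)
    = dist s (A s t (kNeighborhood P k s)) + travelled A k P (A s t (kNeighborhood P k s)) t n := by
  rw [travelled, Finset.sum_range_succ', add_comm]
  simp only [position_succ (s := s)]
  rfl

lemma arrivesAfter_zero : ArrivesAfter A k P t t 0 :=
  ⟨rfl, by simp⟩

lemma ArrivesAfter.pos (h : ArrivesAfter A k P s t n) (hne : s ≠ t) : 0 < n := by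
  rw [Nat.pos_iff_ne_zero]
  rintro rfl
  exact hne h.1

lemma ArrivesAfter.succ (hne : s ≠ t) (hadj : (halfTheta6 P).Adj s (A s t (kNeighborhood P k s)))
    (h : ArrivesAfter A k P (A s t (kNeighborhood P k s)) t n) :
    ArrivesAfter A k P s t (n + 1) := by
  refine ⟨position_succ.trans h.1, fun m hm => ?_⟩
  cases m with
  | zero => exact ⟨hne, hadj⟩
  | succ m =>
    rw [position_succ, position_succ]
    exact h.2 m (by lia)

lemma exists_pos_forall_le_dist {α : Type*} [MetricSpace α] (S : Finset α) :
    ∃ δ > 0, ∀ u ∈ S, ∀ v ∈ S, u ≠ v → δ ≤ dist u v := by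
  rcases (S : Set α).subsingleton_or_nontrivial with h | h
  · exact ⟨1, one_pos, fun u hu v hv hne => absurd (h hu hv) hne⟩
  · exact ⟨_, S.infsep_pos_iff_nontrivial.2 h, fun u hu v hv hne =>
      Set.infsep_le_dist_of_mem hu hv hne⟩

/-- The number of steps is bounded because no edge is shorter than the least distance in `P`. -/
theorem exists_arrivesAfter_of_potential {Φ : Plane → ℝ → Prop}
    (hnonneg : ∀ ⦃s φ⦄, Φ s φ → 0 ≤ φ)
    (hstep : ∀ ⦃s φ⦄, s ∈ P → s ≠ t → Φ s φ →
      (halfTheta6 P).Adj s (A s t (kNeighborhood P k s)) ∧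
      Φ (A s t (kNeighborhood P k s)) (φ - dist s (A s t (kNeighborhood P k s))))
    {φ : ℝ} (hs : s ∈ P) (hφ : Φ s φ) :
    ∃ n, ArrivesAfter A k P s t n ∧ travelled A k P s t n ≤ φ := by
  obtain ⟨δ, hδ, hle⟩ := exists_pos_forall_le_dist P
  obtain ⟨m, hm⟩ := exists_nat_gt (φ / δ)
  rw [div_lt_iff₀ hδ] at hm
  induction m generalizing s φ with
  | zero => exact absurd (hnonneg hφ) (by simpa using hm)
  | succ m ih =>
    by_cases hst : s = t
    · exact ⟨0, hst ▸ arrivesAfter_zero, by simpa [travelled] using hnonneg hφ⟩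
    obtain ⟨hadj, hφ'⟩ := hstep hs hst hφ
    have hstep_le := hle s hs _ hadj.2.2.1 hadj.1
    push_cast at hm
    obtain ⟨n, hn, htravelled⟩ := ih hadj.2.2.1 hφ' (by linarith)
    exact ⟨n + 1, hn.succ hst hadj, by rw [travelled_succ]; linarith⟩

lemma dist_add_dist_le_travelled {a b : ℕ} (hab : a ≤ b) (hbn : b ≤ n) :
    dist s (position A k P s t a) + dist (position A k P s t a) (position A k P s t b)
      + dist (position A k P s t b) (position A k P s t n) ≤ travelled A k P s t n := by
  set f := position A k P s t
  have hfirst : dist s (f a) ≤ ∑ m ∈ Finset.range a, dist (f m) (f (m + 1)) :=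
    dist_le_range_sum_dist f a
  have hmiddle := dist_le_Ico_sum_dist f hab
  have hlast := dist_le_Ico_sum_dist f hbn
  have hsplit := Finset.sum_range_add_sum_Ico (fun m => dist (f m) (f (m + 1))) (hab.trans hbn)
  have hsplit' := Finset.sum_Ico_consecutive (fun m => dist (f m) (f (m + 1))) hab hbn
  change _ ≤ ∑ m ∈ Finset.range n, dist (f m) (f (m + 1))
  linarith

end Route

/-! ### The routing algorithm -/

/-- For `s` in the cone `C_i` of `t` and `k ≠ i`: the part of the cone `C_k` of `s` that lies inside
the canonical triangle of `t` and `s`. -/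
def sideRegion (k : Fin 3) (s t : Plane) : Set Plane :=
  {p | p ∈ positiveCone k s ∧ coord k p < coord k t}

/-- For `s` in the cone `C_i` of `t`: the part of the canonical triangle of `t` and `s` from which
`s` is seen in the cone `C_i`, with `t` itself included. -/
def centralRegion (i : Fin 3) (s t : Plane) : Set Plane :=
  {x | s ∈ positiveCone i x ∧ (x = t ∨ x ∈ positiveCone i t)}

/-- `v` is a point of `S` that comes first in the direction of the bisector of the cone `C_i`. -/
def Minimizes (i : Fin 3) (S : Set Plane) (v : Plane) : Prop :=
  v ∈ S ∧ ∀ x ∈ S, coord i v ≤ coord i x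

/-- The move from `s` in the cone `C_i` of `t` that keeps close to the side of the canonical
triangle in the cone `C_j` of `s`, when the vertices `N` are seen. -/
inductive Descends (i j : Fin 3) (s t : Plane) (N : Set Plane) : Plane → Prop
  | central {v} (hv : Minimizes j (N ∩ centralRegion i s t) v) : Descends i j s t N v
  | side {v} (hdisj : Disjoint N (centralRegion i s t))
      (hv : Minimizes j (N ∩ positiveCone j s) v) : Descends i j s t N v

/-- `v` is a vertex to which the routing algorithm may forward a message for `t` from `s`, when the
vertices `N` are seen. If `s` is in the cone `C_i` of `t`, the algorithm enters the nearer side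
region when both side regions are occupied, and otherwise leaves an empty side region behind; if
both are empty, it moves along the nearer side. -/
inductive Forwards (s t : Plane) (N : Set Plane) : Plane → Prop
  | toward {i v} (ht : t ∈ positiveCone i s) (hv : Minimizes i (N ∩ positiveCone i s) v) :
      Forwards s t N v
  | intoSide {i j k v} (h : Distinct i j k) (hs : s ∈ positiveCone i t)
      (hj : ¬Disjoint N (sideRegion j s t)) (hk : ¬Disjoint N (sideRegion k s t))
      (hle : coord j t - coord j s ≤ coord k t - coord k s)
      (hv : Minimizes j (N ∩ positiveCone j s) v) : Forwards s t N v
  | awayFromEmpty {i j k v} (h : Distinct i j k) (hs : s ∈ positiveCone i t)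
      (hk : Disjoint N (sideRegion k s t))
      (hj : ¬Disjoint N (sideRegion j s t) ∨ coord j t - coord j s ≤ coord k t - coord k s)
      (hv : Descends i j s t N v) : Forwards s t N v

open Classical in
/-- The routing algorithm of the upper bounds: it forwards the message to any vertex allowed by
`Forwards`, which allows at least one in the situations that occur. -/
noncomputable def router : RoutingAlgorithm := fun s t N =>
  if h : ∃ v, Forwards s t N v then h.choose else s

section Regions

variable {P : Finset Plane} {i j k l : Fin 3} {p r s t v x : Plane}

lemma coord_le_of_eq_or_mem_positiveCone (hx : x = t ∨ x ∈ positiveCone i t) (hl : l ≠ i) :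
    coord l x ≤ coord l t := by
  rcases hx with rfl | hx
  · exact le_rfl
  · exact (coord_lt_of_mem_positiveCone_of_ne hx hl).le

lemma mem_centralRegion_of_mem_sideRegion (h : Distinct i j k) (hv : v = t ∨ v ∈ positiveCone i t)
    (hp : p ∈ sideRegion k v t) (hs : s ∈ positiveCone i p) : p ∈ centralRegion i s t :=
  ⟨hs, .inr ((mem_positiveCone h).2
    ⟨(coord_lt_of_mem_positiveCone_of_ne hp.1 h.2.2).trans_le
      (coord_le_of_eq_or_mem_positiveCone hv h.1.symm), hp.2⟩)⟩

lemma exists_minimizes (hs : s ∈ P) {S : Set Plane} (j : Fin 3)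
    (hS : ¬Disjoint (kNeighborhood P 1 s) S) : ∃ v, Minimizes j (kNeighborhood P 1 s ∩ S) v :=
  Set.exists_min_image _ (coord j) ((finite_kNeighborhood hs).inter_of_left S)
    (Set.not_disjoint_iff_nonempty_inter.1 hS)

lemma minimizes_kNeighborhood_iff (hs : s ∈ P) :
    Minimizes i (kNeighborhood P 1 s ∩ positiveCone i s) v ↔ IsClosest P i s v := by
  constructor
  · rintro ⟨⟨hvN, hv⟩, hmin⟩
    refine ⟨mem_of_mem_kNeighborhood hs hvN, hv, fun x hx hxs => ?_⟩
    obtain ⟨y, hy⟩ := exists_isClosest hx hxs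
    have hadj := (adj_iff_isClosest hy.2.1).2 ⟨hs, hy⟩
    exact coneDist_le_coneDist_iff.2
      ((hmin y ⟨mem_kNeighborhood_one.2 (.inr hadj), hy.2.1⟩).trans (hy.coord_le hx hxs))
  · intro h
    have hadj := (adj_iff_isClosest h.2.1).2 ⟨hs, h⟩
    exact ⟨⟨mem_kNeighborhood_one.2 (.inr hadj), h.2.1⟩,
      fun x hx => h.coord_le (mem_of_mem_kNeighborhood hs hx.1) hx.2⟩

lemma disjoint_kNeighborhood_sideRegion_iff (hs : s ∈ P) :
    Disjoint (kNeighborhood P 1 s) (sideRegion k s t) ↔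
      Disjoint (P : Set Plane) (sideRegion k s t) := by
  refine ⟨fun h => Set.disjoint_left.2 fun p hp hpk => ?_,
    fun h => h.mono_left fun _ => mem_of_mem_kNeighborhood hs⟩
  obtain ⟨y, hy⟩ := exists_isClosest hp hpk.1
  have hadj := (adj_iff_isClosest hy.2.1).2 ⟨hs, hy⟩
  exact Set.disjoint_left.1 h (mem_kNeighborhood_one.2 (.inr hadj))
    ⟨hy.2.1, (hy.coord_le hp hpk.1).trans_lt hpk.2⟩

lemma GeneralPosition.mem_positiveCone_or_of_coord_lt (hP : GeneralPosition P)
    (h : Distinct i j k) (hr : r ∈ P) (hs : s ∈ P) (hlt : coord i r < coord i s) :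
    s ∈ positiveCone i r ∨ r ∈ positiveCone j s ∨ r ∈ positiveCone k s := by
  have hne : s ≠ r := by
    rintro rfl
    exact lt_irrefl _ hlt
  obtain ⟨l, hl⟩ := generalPosition_iff_pairwise.1 hP hs hr hne
  rcases h.eq_or l with rfl | rfl | rfl <;> rcases hl with hl | hl
  · exact absurd hlt (coord_lt_of_mem_positiveCone hl).not_gt
  · exact .inl hl
  · exact .inr (.inl hl)
  · exact absurd hlt (coord_lt_of_mem_positiveCone_of_ne hl h.1).not_gt
  · exact .inr (.inr hl)
  · exact absurd hlt (coord_lt_of_mem_positiveCone_of_ne hl h.2.1).not_gt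

end Regions

section Descent

variable {P : Finset Plane} {i j k : Fin 3} {p s t v : Plane}

/-- Among the vertices of the central region that are at most as far along `C_j` as `p`, the one
that maximizes `coord i` either is adjacent to `s` or has its closest vertex in the side region. -/
lemma exists_mem_centralRegion_or_exists_mem_sideRegion (hP : GeneralPosition P)
    (h : Distinct i j k) (hs : s ∈ P) (hk : Disjoint (P : Set Plane) (sideRegion k s t))
    (hp : p ∈ P) (hps : p ∈ centralRegion i s t) :
    (∃ q ∈ kNeighborhood P 1 s, q ∈ centralRegion i s t ∧ coord j q ≤ coord j p) ∨
    ∃ r ∈ P, r ∈ sideRegion j s t ∧ coord j r < coord j p := by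
  obtain ⟨q, ⟨hq, ⟨hsq, hqt⟩, hqp⟩, hmax⟩ :=
    ((P : Set Plane) ∩ {q | q ∈ centralRegion i s t ∧ coord j q ≤ coord j p}).exists_max_image
      (coord i) (P.finite_toSet.inter_of_left _) ⟨p, hp, hps, le_rfl⟩
  obtain ⟨r, hr⟩ := exists_isClosest hs hsq
  have hrq {l : Fin 3} (hl : l ≠ i) : coord l r < coord l q :=
    coord_lt_of_mem_positiveCone_of_ne hr.2.1 hl
  have hri := hr.coord_le hs hsq
  rcases hri.eq_or_lt with heq | hlt
  · have hrs : r = s := by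
      by_contra hne
      exact hP.coord_ne hr.1 hs hne i heq
    have hadj := ((adj_iff_isClosest hsq).2 ⟨hq, hrs ▸ hr⟩).symm
    exact .inl ⟨q, mem_kNeighborhood_one.2 (.inr hadj), ⟨hsq, hqt⟩, hqp⟩
  right
  rcases hP.mem_positiveCone_or_of_coord_lt h hr.1 hs hlt with hsr | hrj | hrk
  · have hrt : r ∈ positiveCone i t := by
      rcases hqt with rfl | hqt
      · exact hr.2.1
      · exact positiveCone_trans hqt hr.2.1
    have hrmax := hmax r ⟨hr.1, ⟨hsr, .inr hrt⟩, ((hrq h.1.symm).trans_le hqp).le⟩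
    exact absurd hrmax (coord_lt_of_mem_positiveCone hr.2.1).not_ge
  · exact ⟨r, hr.1,
      ⟨hrj, (hrq h.1.symm).trans_le (coord_le_of_eq_or_mem_positiveCone hqt h.1.symm)⟩,
      (hrq h.1.symm).trans_le hqp⟩
  · exact absurd
      ⟨hrk, (hrq h.2.1.symm).trans_le (coord_le_of_eq_or_mem_positiveCone hqt h.2.1.symm)⟩
      (Set.disjoint_left.1 hk hr.1)

lemma disjoint_sideRegion_of_minimizes_centralRegion (hP : GeneralPosition P) (h : Distinct i j k)
    (hs : s ∈ P) (hk : Disjoint (P : Set Plane) (sideRegion k s t))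
    (hv : Minimizes j (kNeighborhood P 1 s ∩ centralRegion i s t) v) :
    Disjoint (P : Set Plane) (sideRegion k v t) := by
  obtain ⟨⟨hvN, hsv, hvt⟩, hmin⟩ := hv
  have hclosest : IsClosest P i v s := by
    rcases mem_kNeighborhood_one.1 hvN with rfl | hadj
    · exact absurd rfl (ne_of_mem_positiveCone hsv)
    · exact ((adj_iff_isClosest hsv).1 hadj.symm).2
  have hksv := coord_lt_of_mem_positiveCone_of_ne hsv h.2.1.symm
  refine Set.disjoint_left.2 fun p hp hpv => ?_
  have hjpv := coord_lt_of_mem_positiveCone_of_ne hpv.1 h.2.2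
  have hkvp := coord_lt_of_mem_positiveCone hpv.1
  have hips : coord i p < coord i s := (coord_lt_of_mem_positiveCone_of_ne hpv.1 h.2.1).trans
    (coord_lt_of_mem_positiveCone hsv)
  rcases hP.mem_positiveCone_or_of_coord_lt h hp hs hips with hsp | hpj | hpk
  · have hpc := mem_centralRegion_of_mem_sideRegion h hvt hpv hsp
    rcases exists_mem_centralRegion_or_exists_mem_sideRegion hP h hs hk hp hpc with
      ⟨q, hq, hqc, hqp⟩ | ⟨r, hr, hrs, hrp⟩
    · linarith [hmin q ⟨hq, hqc⟩]
    · have hrv : r ∈ positiveCone i v := (mem_positiveCone h).2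
        ⟨by linarith, by linarith [coord_lt_of_mem_positiveCone_of_ne hrs.1 h.2.2.symm]⟩
      exact absurd (hclosest.coord_le hr hrv)
        (coord_lt_of_mem_positiveCone_of_ne hrs.1 h.1).not_ge
  · linarith [coord_lt_of_mem_positiveCone_of_ne hpj h.2.2.symm]
  · exact Set.disjoint_left.1 hk hp ⟨hpk, hpv.2⟩

lemma disjoint_sideRegion_of_isClosest (hP : GeneralPosition P) (h : Distinct i j k)
    (hs : s ∈ P) (hk : Disjoint (P : Set Plane) (sideRegion k s t))
    (hcentral : Disjoint (kNeighborhood P 1 s) (centralRegion i s t)) (hv : IsClosest P j s v)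
    (hvt : v ∈ positiveCone i t) : Disjoint (P : Set Plane) (sideRegion k v t) := by
  refine Set.disjoint_left.2 fun p hp hpv => ?_
  have hjpv := coord_lt_of_mem_positiveCone_of_ne hpv.1 h.2.2
  have hips : coord i p < coord i s := (coord_lt_of_mem_positiveCone_of_ne hpv.1 h.2.1).trans
    (coord_lt_of_mem_positiveCone_of_ne hv.2.1 h.1)
  rcases hP.mem_positiveCone_or_of_coord_lt h hp hs hips with hsp | hpj | hpk
  · have hpc := mem_centralRegion_of_mem_sideRegion h (.inr hvt) hpv hsp
    rcases exists_mem_centralRegion_or_exists_mem_sideRegion hP h hs hk hp hpc with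
      ⟨q, hq, hqc, -⟩ | ⟨r, hr, hrs, hrp⟩
    · exact Set.disjoint_left.1 hcentral hq hqc
    · linarith [hv.coord_le hr hrs.1]
  · exact absurd (hv.coord_le hp hpj) hjpv.not_ge
  · exact Set.disjoint_left.1 hk hp ⟨hpk, hpv.2⟩

lemma exists_mem_sideRegion (hP : GeneralPosition P) (h : Distinct i j k) (hs : s ∈ P) (ht : t ∈ P)
    (hst : s ∈ positiveCone i t) (hk : Disjoint (P : Set Plane) (sideRegion k s t))
    (hcentral : Disjoint (kNeighborhood P 1 s) (centralRegion i s t)) :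
    ∃ r ∈ P, r ∈ sideRegion j s t := by
  rcases exists_mem_centralRegion_or_exists_mem_sideRegion (j := j) hP h hs hk ht
    ⟨hst, .inl rfl⟩ with ⟨q, hq, hqc, -⟩ | ⟨r, hr, hrs, -⟩
  · exact absurd hqc (Set.disjoint_left.1 hcentral hq)
  · exact ⟨r, hr, hrs⟩

lemma exists_descends (hP : GeneralPosition P) (h : Distinct i j k) (hs : s ∈ P) (ht : t ∈ P)
    (hst : s ∈ positiveCone i t) (hk : Disjoint (P : Set Plane) (sideRegion k s t)) :
    ∃ v, Descends i j s t (kNeighborhood P 1 s) v := by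
  by_cases hcentral : Disjoint (kNeighborhood P 1 s) (centralRegion i s t)
  · obtain ⟨r, hr, hrs⟩ := exists_mem_sideRegion hP h hs ht hst hk hcentral
    obtain ⟨v, hv⟩ := exists_isClosest hr hrs.1
    exact ⟨v, .side hcentral ((minimizes_kNeighborhood_iff hs).2 hv)⟩
  · obtain ⟨v, hv⟩ := exists_minimizes hs j hcentral
    exact ⟨v, .central hv⟩

lemma exists_forwards (hP : GeneralPosition P) (hs : s ∈ P) (ht : t ∈ P) (hne : s ≠ t) :
    ∃ v, Forwards s t (kNeighborhood P 1 s) v := by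
  obtain ⟨i, hts | hst⟩ := generalPosition_iff_pairwise.1 hP hs ht hne
  · obtain ⟨v, hv⟩ := exists_isClosest ht hts
    exact ⟨v, .toward hts ((minimizes_kNeighborhood_iff hs).2 hv)⟩
  obtain ⟨j, k, h, hle⟩ : ∃ j k, Distinct i j k ∧ coord j t - coord j s ≤ coord k t - coord k s :=
    exists_distinct_le i fun l => coord l t - coord l s
  have hempty := fun l => disjoint_kNeighborhood_sideRegion_iff (k := l) (t := t) hs
  by_cases hk : Disjoint (kNeighborhood P 1 s) (sideRegion k s t)
  · obtain ⟨v, hv⟩ := exists_descends hP h hs ht hst ((hempty k).1 hk)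
    exact ⟨v, .awayFromEmpty h hst hk (.inr hle) hv⟩
  by_cases hj : Disjoint (kNeighborhood P 1 s) (sideRegion j s t)
  · obtain ⟨v, hv⟩ := exists_descends hP h.swap hs ht hst ((hempty j).1 hj)
    exact ⟨v, .awayFromEmpty h.swap hst hj (.inl hk) hv⟩
  · obtain ⟨p, hp, hps⟩ := Set.not_disjoint_iff.1 hj
    obtain ⟨v, hv⟩ := exists_minimizes (S := positiveCone j s) hs j
      (Set.not_disjoint_iff.2 ⟨p, hp, hps.1⟩)
    exact ⟨v, .intoSide h hst hj hk hle hv⟩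

lemma forwards_router (hP : GeneralPosition P) (hs : s ∈ P) (ht : t ∈ P) (hne : s ≠ t) :
    Forwards s t (kNeighborhood P 1 s) (router s t (kNeighborhood P 1 s)) := by
  have h := exists_forwards hP hs ht hne
  rw [router, dif_pos h]
  exact h.choose_spec

end Descent

/-- `φ` is an upper bound for the length of the path that the router follows from a vertex to `t`:
one of the two bounds of the theorem or, when a side region of the vertex is known to be empty, the
improved bound for keeping to the other side. -/
inductive PotentialLE (P : Finset Plane) (t : Plane) : Plane → ℝ → Prop
  | arrived {φ} (hφ : 0 ≤ φ) : PotentialLE P t t φ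
  | positive {i s φ} (ht : t ∈ positiveCone i s) (hφ : positiveBound i s t ≤ φ) :
      PotentialLE P t s φ
  | negative {i s φ} (hs : s ∈ positiveCone i t) (hφ : negativeBound i t s ≤ φ) :
      PotentialLE P t s φ
  | emptySide {i j k s φ} (h : Distinct i j k) (hs : s ∈ positiveCone i t)
      (hk : Disjoint (P : Set Plane) (sideRegion k s t))
      (hφ : coord i s - coord i t + (coord j t - coord j s) ≤ φ) : PotentialLE P t s φ

section Potential

variable {P : Finset Plane} {i j k : Fin 3} {p s t u v w : Plane} {φ : ℝ}

lemma coord_add_le_positiveBound (h : Distinct i j k) (hw : w ∈ positiveCone i u) :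
    coord i w - coord i u + (coord j u - coord j w) ≤ positiveBound i u w := by
  rw [positiveBound_eq h hw]
  gcongr
  exact le_max_left _ _

lemma coord_add_le_negativeBound (h : Distinct i j k) (hw : w ∈ positiveCone i u) :
    coord i w - coord i u + (coord j u - coord j w) ≤ negativeBound i u w := by
  obtain ⟨hj, hk⟩ := (mem_positiveCone h).1 hw
  rw [negativeBound_eq h hw]
  linarith [le_min (sub_nonneg.2 hj.le) (sub_nonneg.2 hk.le), coord_add_add_eq_zero h u,
    coord_add_add_eq_zero h w]

lemma PotentialLE.nonneg (hφ : PotentialLE P t s φ) : 0 ≤ φ := by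
  cases hφ with
  | arrived hφ => exact hφ
  | @positive i _ _ ht hφ =>
    linarith [coord_add_le_positiveBound (distinct_add i) ht, coord_lt_of_mem_positiveCone ht,
      ((mem_positiveCone (distinct_add i)).1 ht).1]
  | @negative i _ _ hs hφ =>
    linarith [coord_add_le_negativeBound (distinct_add i) hs, coord_lt_of_mem_positiveCone hs,
      ((mem_positiveCone (distinct_add i)).1 hs).1]
  | emptySide h hs _ hφ =>
    linarith [coord_lt_of_mem_positiveCone hs, ((mem_positiveCone h).1 hs).1]

lemma PotentialLE.positiveBound_le (ht : t ∈ positiveCone i s) (hφ : PotentialLE P t s φ) :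
    positiveBound i s t ≤ φ := by
  cases hφ with
  | arrived => exact absurd rfl (ne_of_mem_positiveCone ht)
  | positive ht' hφ => rwa [eq_of_mem_positiveCone ht ht']
  | negative hs => exact absurd hs (not_mem_positiveCone_of_mem ht)
  | emptySide _ hs => exact absurd hs (not_mem_positiveCone_of_mem ht)

lemma PotentialLE.negativeBound_le_or (h : Distinct i j k) (hs : s ∈ positiveCone i t)
    (hφ : PotentialLE P t s φ) : negativeBound i t s ≤ φ ∨
    (Disjoint (P : Set Plane) (sideRegion k s t) ∧
      coord i s - coord i t + (coord j t - coord j s) ≤ φ) ∨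
    (Disjoint (P : Set Plane) (sideRegion j s t) ∧
      coord i s - coord i t + (coord k t - coord k s) ≤ φ) := by
  cases hφ with
  | arrived => exact absurd rfl (ne_of_mem_positiveCone hs)
  | positive ht => exact absurd ht (not_mem_positiveCone_of_mem hs)
  | negative hs' hφ => exact .inl (by rwa [eq_of_mem_positiveCone hs hs'])
  | emptySide h' hs' hk hφ =>
    obtain rfl := eq_of_mem_positiveCone hs hs'
    rcases h.eq_or_swap h' with ⟨rfl, rfl⟩ | ⟨rfl, rfl⟩
    · exact .inr (.inl ⟨hk, hφ⟩)
    · exact .inr (.inr ⟨hk, hφ⟩)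

lemma PotentialLE.of_isClosest_of_lt (h : Distinct i j k) (hts : t ∈ positiveCone i s)
    (hv : IsClosest P i s v) (hi : coord i v < coord i t) (hk : coord k v < coord k t)
    (hφ : positiveBound i s t ≤ φ) :
    PotentialLE P t v (φ - dist s v) := by
  have hjv := ((mem_positiveCone h).1 hv.2.1).1
  refine .emptySide h.rotate.swap ((mem_positiveCone h.rotate).2 ⟨hk, hi⟩)
    (Set.disjoint_left.2 fun p hp hpv => ?_) ?_
  · obtain ⟨hip, hjp⟩ := (mem_positiveCone h.rotate.rotate).1 hpv.1
    have hps : p ∈ positiveCone i s :=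
      (mem_positiveCone h).2 ⟨hjp.trans hjv, hpv.2.trans ((mem_positiveCone h).1 hts).2⟩
    exact absurd (hv.coord_le hp hps) hip.not_ge
  · linarith [dist_le_of_mem_positiveCone hv.2.1, coord_add_le_positiveBound h hts]

/-- Unless `v` is the destination, the destination is in the same positive cone of `v` as of `s`, or
`v` is in one of the other two positive cones of the destination. -/
lemma PotentialLE.of_isClosest (hP : GeneralPosition P) (ht : t ∈ P) (hts : t ∈ positiveCone i s)
    (hv : IsClosest P i s v) (hφ : positiveBound i s t ≤ φ) :
    PotentialLE P t v (φ - dist s v) := by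
  have h := distinct_add i
  have hdist := dist_le_of_mem_positiveCone hv.2.1
  rcases eq_or_ne v t with rfl | hne
  · exact .arrived (by linarith [coord_add_le_positiveBound h hts, ((mem_positiveCone h).1 hts).1])
  have hi := lt_of_le_of_ne (hv.coord_le ht hts) (hP.coord_ne hv.1 ht hne i)
  rcases lt_or_gt_of_ne (hP.coord_ne hv.1 ht hne (i + 1)) with hj | hj <;>
    rcases lt_or_gt_of_ne (hP.coord_ne hv.1 ht hne (i + 2)) with hk | hk
  · linarith [coord_add_add_eq_zero h v, coord_add_add_eq_zero h t]
  · exact .of_isClosest_of_lt h.swap hts hv hi hj hφ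
  · exact .of_isClosest_of_lt h hts hv hi hk hφ
  · have htv : t ∈ positiveCone i v := (mem_positiveCone h).2 ⟨hj, hk⟩
    obtain ⟨hjv, hkv⟩ := (mem_positiveCone h).1 hv.2.1
    refine .positive htv ?_
    rw [positiveBound_eq h htv]
    have hmax : max (coord (i + 1) v - coord (i + 1) t) (coord (i + 2) v - coord (i + 2) t)
        ≤ max (coord (i + 1) s - coord (i + 1) t) (coord (i + 2) s - coord (i + 2) t) := by gcongr
    linarith [positiveBound_eq h hts]

lemma Descends.adj_and_potentialLE (hP : GeneralPosition P) (h : Distinct i j k) (hs : s ∈ P)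
    (ht : t ∈ P) (hst : s ∈ positiveCone i t) (hk : Disjoint (P : Set Plane) (sideRegion k s t))
    (hφ : coord i s - coord i t + (coord j t - coord j s) ≤ φ)
    (hv : Descends i j s t (kNeighborhood P 1 s) v) :
    (halfTheta6 P).Adj s v ∧ PotentialLE P t v (φ - dist s v) := by
  obtain ⟨hjst, hkst⟩ := (mem_positiveCone h).1 hst
  cases hv with
  | central hv =>
    obtain ⟨hvN, hsv, hvt⟩ := hv.1
    have hadj := (mem_kNeighborhood_one.1 hvN).resolve_left (ne_of_mem_positiveCone hsv).symm
    have hdist := dist_le_of_mem_positiveCone hsv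
    have hjv := coord_lt_of_mem_positiveCone_of_ne hsv h.1.symm
    rw [dist_comm] at hdist
    refine ⟨hadj, ?_⟩
    have hempty := disjoint_sideRegion_of_minimizes_centralRegion hP h hs hk hv
    rcases hvt with rfl | hvt
    · exact .arrived (by linarith)
    · exact .emptySide h hvt hempty (by linarith)
  | side hcentral hv =>
    have hclosest := (minimizes_kNeighborhood_iff hs).1 hv
    have hsv := hclosest.2.1
    obtain ⟨r, hr, hrs, hrt⟩ := exists_mem_sideRegion hP h hs ht hst hk hcentral
    have hvt : v ∈ positiveCone i t := (mem_positiveCone h).2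
      ⟨(hclosest.coord_le hr hrs).trans_lt hrt,
        (coord_lt_of_mem_positiveCone_of_ne hsv h.2.2.symm).trans hkst⟩
    have hempty := disjoint_sideRegion_of_isClosest hP h hs hk hcentral hclosest hvt
    refine ⟨(adj_iff_isClosest hsv).2 ⟨hs, hclosest⟩, .emptySide h hvt hempty ?_⟩
    linarith [dist_le_of_mem_positiveCone hsv, coord_lt_of_mem_positiveCone_of_ne hsv h.1]

lemma Forwards.adj_and_potentialLE (hP : GeneralPosition P) (hs : s ∈ P) (ht : t ∈ P)
    (hφ : PotentialLE P t s φ) (hv : Forwards s t (kNeighborhood P 1 s) v) :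
    (halfTheta6 P).Adj s v ∧ PotentialLE P t v (φ - dist s v) := by
  cases hv with
  | toward hts hv =>
    have hclosest := (minimizes_kNeighborhood_iff hs).1 hv
    exact ⟨(adj_iff_isClosest hv.1.2).2 ⟨hs, hclosest⟩,
      .of_isClosest hP ht hts hclosest (hφ.positiveBound_le hts)⟩
  | @intoSide i j k _ h hst hj hk hle hv =>
    have hclosest := (minimizes_kNeighborhood_iff hs).1 hv
    have hsv := hclosest.2.1
    refine ⟨(adj_iff_isClosest hsv).2 ⟨hs, hclosest⟩, ?_⟩
    rw [disjoint_kNeighborhood_sideRegion_iff hs] at hj hk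
    have hbound : negativeBound i t s ≤ φ := by
      rcases hφ.negativeBound_le_or h hst with hbound | ⟨hempty, -⟩ | ⟨hempty, -⟩
      exacts [hbound, absurd hempty hk, absurd hempty hj]
    rw [negativeBound_eq h hst, min_eq_left hle] at hbound
    obtain ⟨p, hp, hps, hpt⟩ := Set.not_disjoint_iff.1 hj
    have hvt : v ∈ positiveCone i t := (mem_positiveCone h).2
      ⟨(hclosest.coord_le hp hps).trans_lt hpt, (coord_lt_of_mem_positiveCone_of_ne hsv
        h.2.2.symm).trans ((mem_positiveCone h).1 hst).2⟩
    refine .negative hvt ?_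
    rw [negativeBound_eq h hvt]
    linarith [min_le_left (coord j t - coord j v) (coord k t - coord k v),
      dist_le_of_mem_positiveCone hsv, coord_lt_of_mem_positiveCone_of_ne hsv h.1]
  | @awayFromEmpty i j k _ h hst hk hj hv =>
    rw [disjoint_kNeighborhood_sideRegion_iff hs] at hj hk
    refine hv.adj_and_potentialLE hP h hs ht hst hk ?_
    rcases hφ.negativeBound_le_or h hst with hbound | ⟨-, hbound⟩ | ⟨hempty, hbound⟩
    · exact (coord_add_le_negativeBound h hst).trans hbound
    · exact hbound
    · linarith [hj.resolve_left (not_not.2 hempty)]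

end Potential

theorem router_arrives {P : Finset Plane} (hP : GeneralPosition P) {s t : Plane} {φ : ℝ}
    (hs : s ∈ P) (ht : t ∈ P) (hφ : PotentialLE P t s φ) :
    ∃ n, ArrivesAfter router 1 P s t n ∧ travelled router 1 P s t n ≤ φ :=
  exists_arrivesAfter_of_potential (fun _ _ => PotentialLE.nonneg)
    (fun _ _ hs hne hφ => (forwards_router hP hs ht hne).adj_and_potentialLE hP hs ht hφ) hs hφ

/-! ### Lower bounds -/

section Insert

variable {P : Finset Plane} {i : Fin 3} {u v w x y z : Plane}

lemma eq_of_adj_of_forall_coord_lt (hP : ∀ x ∈ P, x ≠ u → x ∈ positiveCone i u) (hv : v ∈ P)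
    (hvu : v ≠ u) (hmin : ∀ x ∈ P, x ≠ u → x ≠ v → coord i v < coord i x)
    (hadj : (halfTheta6 P).Adj u x) : x = v := by
  by_contra hxv
  have hclosest := ((adj_iff_isClosest (hP x hadj.2.2.1 hadj.ne')).1 hadj).2
  exact (hmin x hadj.2.2.1 hadj.ne' hxv).not_ge (hclosest.coord_le hv (hP v hv hvu))

open Classical in
lemma generalPosition_insert : GeneralPosition (insert v P) ↔ GeneralPosition P ∧
    ∀ u ∈ P, v ≠ u → ∃ i, u ∈ positiveCone i v ∨ v ∈ positiveCone i u := by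
  have hsymm : Std.Symm fun u v : Plane => ∃ i, v ∈ positiveCone i u ∨ u ∈ positiveCone i v :=
    ⟨fun _ _ ⟨i, h⟩ => ⟨i, h.symm⟩⟩
  rw [generalPosition_iff_pairwise, generalPosition_iff_pairwise, Finset.coe_insert,
    Set.pairwise_insert_of_symm]
  rfl

open Classical in
lemma generalPosition_pair (hw : w ∈ positiveCone i u) : GeneralPosition {u, w} := by
  refine generalPosition_insert.2 ⟨?_, ?_⟩
  · simp [generalPosition_iff_pairwise]
  · simpa using fun _ => ⟨i, .inl hw⟩

open Classical in
lemma isClosest_insert_iff (hy : y ∈ P) (hz : z ∈ positiveCone i x → coord i y ≤ coord i z) :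
    IsClosest (insert z P) i x y ↔ IsClosest P i x y := by
  simp only [IsClosest, coneDist_le_coneDist_iff, Finset.mem_insert, hy, or_true, forall_eq_or_imp]
  tauto

open Classical in
lemma adj_insert_iff (hx : x ∈ P) (hy : y ∈ P)
    (hxy : ∀ l, z ∈ positiveCone l x → coord l y ≤ coord l z)
    (hyx : ∀ l, z ∈ positiveCone l y → coord l x ≤ coord l z) :
    (halfTheta6 (insert z P)).Adj x y ↔ (halfTheta6 P).Adj x y := by
  simp only [halfTheta6, isClosest_insert_iff hy (hxy _), isClosest_insert_iff hx (hyx _),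
    Finset.mem_insert, hx, hy, or_true]

end Insert

open Classical in
/-- The third vertex is the only neighbour of `u`, and it is near the corner of the canonical
triangle that is farther from `w`. -/
theorem exists_lt_travelled_of_lt_positiveBound (k : ℕ) (A : RoutingAlgorithm) {i : Fin 3}
    {u w : Plane} (hw : w ∈ positiveCone i u) {L : ℝ} (hL : L < positiveBound i u w) :
    ∃ P : Finset Plane, GeneralPosition P ∧ u ∈ P ∧ w ∈ P ∧
      ∀ n, ArrivesAfter A k P u w n → L < travelled A k P u w n := by
  obtain ⟨l, j, h, hle⟩ := exists_distinct_le i fun m => coord m u - coord m w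
  rw [positiveBound_eq h hw, max_eq_right hle] at hL
  obtain ⟨hlw, hjw⟩ := (mem_positiveCone h).1 hw
  obtain ⟨ε, hε, hlt⟩ : ∃ ε > 0, ε < min ((coord j u - coord j w) / 2)
      ((coord i w - coord i u + (coord j u - coord j w) - L) / 3) :=
    exists_between (lt_min (by linarith) (by linarith))
  obtain ⟨hεj, hεL⟩ := lt_min_iff.1 hlt
  obtain ⟨v, hvi, hvj⟩ := exists_coord_eq_and_eq h.swap (coord i w - ε) (coord j u - ε)
  have hsum (p : Plane) := coord_add_add_eq_zero h p
  have hvu : v ∈ positiveCone i u :=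
    (mem_positiveCone h).2 ⟨by linarith [hsum u, hsum v, hsum w], by linarith⟩
  have hvw : v ∈ positiveCone j w :=
    (mem_positiveCone h.rotate.rotate).2 ⟨by linarith, by linarith [hsum v, hsum w]⟩
  refine ⟨{v, u, w}, ?_, by simp, by simp, fun n hn => ?_⟩
  · refine generalPosition_insert.2 ⟨generalPosition_pair hw, ?_⟩
    rintro x hx -
    rcases Finset.mem_insert.1 hx with rfl | hx
    · exact ⟨i, .inr hvu⟩
    · exact ⟨j, .inr (Finset.mem_singleton.1 hx ▸ hvw)⟩
  · have hadj := (hn.2 0 (hn.pos (ne_of_mem_positiveCone hw).symm)).2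
    have hfirst : position A k {v, u, w} u w 1 = v := by
      refine eq_of_adj_of_forall_coord_lt (i := i) (u := u) ?_ (by simp)
        (ne_of_mem_positiveCone hvu) ?_ hadj
      · simp [hw, hvu]
      · simp [hvi, hε]
    have hlength := dist_add_dist_le_travelled (A := A) (k := k) (P := {v, u, w}) (s := u) (t := w)
      (le_refl 1) (hn.pos (ne_of_mem_positiveCone hw).symm)
    rw [hfirst, hn.1, dist_self, dist_comm u v] at hlength
    linarith [coord_sub_coord_le_two_mul_dist h.rotate.rotate v u,
      coord_sub_coord_le_two_mul_dist h.swap v w, hsum u, hsum v, hsum w]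

/-- The points of the lower bound for routing from `w` to `u` in the positive cone `C_i` of `u`:
they descend from `w` towards `u` and approach, alternately, the two other corners of the canonical
triangle. The point with index `m` is near the boundary of the cone on which `coord (side m)` is
constant. -/
structure Strip (i : Fin 3) (u w : Plane) where
  margin : ℝ
  side : ℕ → Fin 3
  depth : ℕ → ℝ
  point : ℕ → Plane
  distinct : ∀ m, Distinct i (side m) (side (m + 1))
  depth_strictMono : StrictMono depth
  depth_zero : depth 0 = 0
  depth_lt : ∀ m, depth m < margin
  two_mul_margin_lt : ∀ m, 2 * margin < coord (side m) u - coord (side m) w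
  coord_point : ∀ m, coord i (point m) = coord i w - depth m
  coord_side_point : ∀ m,
    coord (side m) (point m) = coord (side m) u - (margin - depth m) / 2

namespace Strip

section Points

variable {i : Fin 3} {u w : Plane} (S : Strip i u w) {m n M : ℕ} {x : Plane}

lemma side_succ_eq (h : S.side n ≠ S.side m) : S.side (n + 1) = S.side m :=
  (((S.distinct n).eq_or (S.side m)).resolve_left (S.distinct m).1.symm).resolve_left h.symm |>.symm

lemma side_succ_eq_side_succ (h : S.side n = S.side m) : S.side (n + 1) = S.side (m + 1) :=
  (((S.distinct m).eq_or_swap (h ▸ S.distinct n)).resolve_right fun h' =>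
    (S.distinct m).2.2 h'.1).2

lemma side_add_two (m : ℕ) : S.side (m + 2) = S.side m :=
  S.side_succ_eq (S.distinct m).2.2.symm

lemma depth_nonneg (m : ℕ) : 0 ≤ S.depth m :=
  S.depth_zero ▸ S.depth_strictMono.monotone m.zero_le

lemma depth_pos (hm : 1 ≤ m) : 0 < S.depth m :=
  S.depth_zero ▸ S.depth_strictMono hm

lemma margin_pos : 0 < S.margin :=
  S.depth_zero ▸ S.depth_lt 0

lemma coord_side_succ_point (m : ℕ) : coord (S.side (m + 1)) (S.point m)
    = coord (S.side (m + 1)) u - (coord i w - coord i u) + (S.margin + S.depth m) / 2 := by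
  linarith [coord_add_add_eq_zero (S.distinct m) (S.point m),
    coord_add_add_eq_zero (S.distinct m) u, S.coord_point m, S.coord_side_point m]

lemma coord_point_lt (h : m < n) : coord i (S.point n) < coord i (S.point m) := by
  rw [S.coord_point, S.coord_point]
  exact sub_lt_sub_left (S.depth_strictMono h) _

lemma coord_side_point_lt (hside : S.side n = S.side m) (h : m < n) :
    coord (S.side m) (S.point m) < coord (S.side m) (S.point n) := by
  have hn := S.coord_side_point n
  rw [hside] at hn
  linarith [S.coord_side_point m, S.depth_strictMono h]

lemma point_injective : S.point.Injective :=
  .of_lt_imp_ne fun _ _ h heq => (S.coord_point_lt h).ne (by rw [heq])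

include S in
lemma apex_mem_positiveCone : w ∈ positiveCone i u :=
  (mem_positiveCone (S.distinct 0)).2 ⟨by linarith [S.two_mul_margin_lt 0, S.margin_pos],
    by linarith [S.two_mul_margin_lt 1, S.margin_pos]⟩

lemma point_mem_positiveCone (m : ℕ) : S.point m ∈ positiveCone i u := by
  have hm := S.depth_lt m
  refine (mem_positiveCone (S.distinct m)).2 ⟨by linarith [S.coord_side_point m], ?_⟩
  linarith [S.margin_pos, S.coord_side_succ_point m, S.two_mul_margin_lt m,
    S.two_mul_margin_lt (m + 1), coord_add_add_eq_zero (S.distinct m) u,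
    coord_add_add_eq_zero (S.distinct m) w]

lemma point_mem_positiveCone_apex (hm : 1 ≤ m) : S.point m ∈ positiveCone (S.side m) w := by
  refine (mem_positiveCone (S.distinct m).rotate).2
    ⟨?_, by linarith [S.coord_point m, S.depth_pos hm]⟩
  linarith [S.margin_pos, S.coord_side_succ_point m, S.depth_lt m, S.two_mul_margin_lt m,
    coord_add_add_eq_zero (S.distinct m) u, coord_add_add_eq_zero (S.distinct m) w]

lemma point_mem_positiveCone_of_side_eq (h : m < n) (hside : S.side n = S.side m) :
    S.point m ∈ positiveCone i (S.point n) := by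
  refine (mem_positiveCone (S.distinct m)).2 ⟨S.coord_side_point_lt hside h, ?_⟩
  have hn := S.coord_side_succ_point n
  rw [S.side_succ_eq_side_succ hside] at hn
  linarith [S.coord_side_succ_point m, S.depth_strictMono h]

lemma point_mem_positiveCone_of_side_ne (h : m < n) (hside : S.side n ≠ S.side m) :
    S.point n ∈ positiveCone (S.side n) (S.point m) := by
  refine (mem_positiveCone (S.distinct n).rotate).2 ⟨?_, S.coord_point_lt h⟩
  have hn := S.coord_side_succ_point n
  rw [S.side_succ_eq hside] at hn ⊢
  have hsum (p : Plane) := coord_add_add_eq_zero (S.distinct m) p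
  linarith [S.coord_side_point m, S.two_mul_margin_lt m, S.two_mul_margin_lt (m + 1), S.depth_lt n,
    S.margin_pos, S.depth_nonneg m, hsum u, hsum w]

open Classical in
/-- The lower-bound instance for routing from `w` to `u` in which the vertices are `u`, `w` and the
points of index `1` to `M`. -/
noncomputable def points (M : ℕ) : Finset Plane := {u, w} ∪ (Finset.Icc 1 M).image S.point

lemma mem_points : x ∈ S.points M ↔ x = u ∨ x = w ∨ ∃ m, 1 ≤ m ∧ m ≤ M ∧ S.point m = x := by
  simp [points, and_assoc]

lemma base_mem_points : u ∈ S.points M := S.mem_points.2 (.inl rfl)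

lemma apex_mem_points : w ∈ S.points M := S.mem_points.2 (.inr (.inl rfl))

lemma point_mem_points (hm : 1 ≤ m) (hmM : m ≤ M) : S.point m ∈ S.points M :=
  S.mem_points.2 (.inr (.inr ⟨m, hm, hmM, rfl⟩))

lemma points_mono (h : m ≤ n) : S.points m ⊆ S.points n := by
  intro x
  simp only [mem_points]
  grind

open Classical in
lemma points_succ (M : ℕ) : S.points (M + 1) = insert (S.point (M + 1)) (S.points M) := by
  rw [points, ← Finset.insert_Icc_right_eq_Icc_add_one (by lia), Finset.image_insert,
    Finset.union_insert, points]

lemma mem_positiveCone_of_mem_points (hx : x ∈ S.points M) (hxu : x ≠ u) :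
    x ∈ positiveCone i u := by
  rcases S.mem_points.1 hx with rfl | rfl | ⟨m, -, -, rfl⟩
  · exact absurd rfl hxu
  · exact S.apex_mem_positiveCone
  · exact S.point_mem_positiveCone m

lemma mem_positiveCone_or_of_mem_points (hx : x ∈ S.points M) (hxu : x ≠ u) :
    x ∈ positiveCone i (S.point (M + 1)) ∨ S.point (M + 1) ∈ positiveCone (S.side (M + 1)) x := by
  rcases S.mem_points.1 hx with rfl | rfl | ⟨m, -, hmM, rfl⟩
  · exact absurd rfl hxu
  · exact .inr (S.point_mem_positiveCone_apex (by lia))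
  · by_cases hside : S.side (M + 1) = S.side m
    · exact .inl (S.point_mem_positiveCone_of_side_eq (by lia) hside)
    · exact .inr (S.point_mem_positiveCone_of_side_ne (by lia) hside)

lemma coord_lt_and_lt_of_mem_points (hx : x ∈ S.points M) (hxu : x ≠ u) :
    coord i (S.point (M + 1)) < coord i x ∧
      coord (S.side (M + 1)) x < coord (S.side (M + 1)) (S.point (M + 1)) := by
  have hne := (S.distinct (M + 1)).1
  rcases S.mem_positiveCone_or_of_mem_points hx hxu with h | h
  · exact ⟨coord_lt_of_mem_positiveCone h, coord_lt_of_mem_positiveCone_of_ne h hne.symm⟩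
  · exact ⟨coord_lt_of_mem_positiveCone_of_ne h hne, coord_lt_of_mem_positiveCone h⟩

lemma generalPosition_points (M : ℕ) : GeneralPosition (S.points M) := by
  induction M with
  | zero => simpa [points] using generalPosition_pair S.apex_mem_positiveCone
  | succ M ih =>
    rw [points_succ, generalPosition_insert]
    refine ⟨ih, fun x hx _ => ?_⟩
    rcases eq_or_ne x u with rfl | hxu
    · exact ⟨i, .inr (S.point_mem_positiveCone _)⟩
    · rcases S.mem_positiveCone_or_of_mem_points hx hxu with h | h
      · exact ⟨i, .inl h⟩
      · exact ⟨_, .inr h⟩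

end Points

section Edges

variable {i : Fin 3} {u w : Plane} (S : Strip i u w) {m n M K : ℕ} {x y : Plane}

lemma eq_point_of_adj_base (hM : 1 ≤ M) (hadj : (halfTheta6 (S.points M)).Adj u x) :
    x = S.point M := by
  obtain ⟨M, rfl⟩ := Nat.exists_eq_add_of_le' hM
  refine eq_of_adj_of_forall_coord_lt (fun x => S.mem_positiveCone_of_mem_points)
    (S.point_mem_points hM le_rfl) (ne_of_mem_positiveCone (S.point_mem_positiveCone _))
    (fun x hx hxu hxM => ?_) hadj
  rw [points_succ, Finset.mem_insert] at hx
  exact (S.coord_lt_and_lt_of_mem_points (hx.resolve_left hxM) hxu).1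

lemma exists_point_of_adj_apex (hM : 1 ≤ M) (hadj : (halfTheta6 (S.points M)).Adj w x) :
    ∃ m, 1 ≤ m ∧ m ≤ 2 ∧ S.point m = x := by
  rcases S.mem_points.1 hadj.2.2.1 with rfl | rfl | ⟨m, hm, hmM, rfl⟩
  · have hwM := S.eq_point_of_adj_base hM hadj.symm
    exact absurd hwM.symm (ne_of_mem_positiveCone (S.point_mem_positiveCone_apex hM))
  · exact absurd rfl hadj.ne
  refine ⟨m, hm, ?_, rfl⟩
  by_contra! hlt
  have hclosest := ((adj_iff_isClosest (S.point_mem_positiveCone_apex hm)).1 hadj).2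
  obtain ⟨m, rfl⟩ := Nat.exists_eq_add_of_le' hlt.le
  rw [S.side_add_two] at hclosest
  have hle := hclosest.coord_le (S.point_mem_points (m := m) (by lia) (by lia))
    (S.point_mem_positiveCone_apex (by lia))
  exact hle.not_gt (S.coord_side_point_lt (S.side_add_two m) (by lia))

lemma le_add_two_of_adj (hm : 1 ≤ m) (hn : n ≤ M)
    (hadj : (halfTheta6 (S.points M)).Adj (S.point m) (S.point n)) : n ≤ m + 2 := by
  by_contra! hlt
  by_cases hside : S.side n = S.side m
  · have hclosest := ((adj_iff_isClosest (S.point_mem_positiveCone_of_side_eq (by lia) hside)).1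
      hadj.symm).2
    obtain ⟨n, rfl⟩ := Nat.exists_eq_add_of_le' (show 2 ≤ n by lia)
    have hle := hclosest.coord_le (S.point_mem_points (m := n) (by lia) (by lia))
      (S.point_mem_positiveCone_of_side_eq (by lia) (S.side_add_two n))
    exact hle.not_gt (S.coord_point_lt (by lia))
  · have hclosest := ((adj_iff_isClosest (S.point_mem_positiveCone_of_side_ne (by lia) hside)).1
      hadj).2
    have hsucc : S.side (m + 1) = S.side n := S.side_succ_eq (Ne.symm hside)
    have hle := hclosest.coord_le (S.point_mem_points (m := m + 1) (by lia) (by lia))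
      (hsucc ▸ S.point_mem_positiveCone_of_side_ne (by lia) (S.distinct m).2.2.symm)
    rw [← hsucc] at hle
    exact hle.not_gt (S.coord_side_point_lt hsucc.symm (by lia))

lemma mem_points_of_mem_kNeighborhood (hM : 2 * n ≤ M)
    (hx : x ∈ kNeighborhood (S.points M) n w) : x ∈ S.points (2 * n) ∧ x ≠ u := by
  induction n generalizing x with
  | zero =>
    rw [kNeighborhood_zero] at hx
    obtain rfl := hx
    exact ⟨S.apex_mem_points, ne_of_mem_positiveCone S.apex_mem_positiveCone⟩
  | succ n ih =>
    rcases mem_kNeighborhood_succ.1 hx with hx | ⟨y, hy, hadj⟩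
    · exact (ih (by lia) hx).imp_left (S.points_mono (by lia) ·)
    obtain ⟨hyn, hyu⟩ := ih (by lia) hy
    have hpoint (m : ℕ) := ne_of_mem_positiveCone (S.point_mem_positiveCone m)
    rcases S.mem_points.1 hyn with rfl | rfl | ⟨l, hl, hln, rfl⟩
    · exact absurd rfl hyu
    · obtain ⟨m, hm, hm2, rfl⟩ := S.exists_point_of_adj_apex (by lia) hadj
      exact ⟨S.point_mem_points hm (by lia), hpoint m⟩
    rcases S.mem_points.1 hadj.2.2.1 with rfl | rfl | ⟨m, hm, hmM, rfl⟩
    · have hlM := S.point_injective (S.eq_point_of_adj_base (by lia) hadj.symm)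
      lia
    · exact ⟨S.apex_mem_points, ne_of_mem_positiveCone S.apex_mem_positiveCone⟩
    · exact ⟨S.point_mem_points hm (by linarith [S.le_add_two_of_adj hl hmM hadj]), hpoint m⟩

lemma adj_points_succ_iff (hx : x ∈ S.points M) (hxu : x ≠ u) (hy : y ∈ S.points M) (hyu : y ≠ u) :
    (halfTheta6 (S.points (M + 1))).Adj x y ↔ (halfTheta6 (S.points M)).Adj x y := by
  have hle ⦃x⦄ (hx : x ∈ S.points M) (hxu : x ≠ u) ⦃y⦄ (hy : y ∈ S.points M) (hyu : y ≠ u)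
      (l : Fin 3) (hl : S.point (M + 1) ∈ positiveCone l x) :
      coord l y ≤ coord l (S.point (M + 1)) := by
    have hside : S.side (M + 1) = l := by
      by_contra hne
      exact (coord_lt_of_mem_positiveCone_of_ne hl hne).not_gt
        (S.coord_lt_and_lt_of_mem_points hx hxu).2
    exact hside ▸ (S.coord_lt_and_lt_of_mem_points hy hyu).2.le
  rw [points_succ]
  exact adj_insert_iff hx hy (hle hx hxu hy hyu) (hle hy hyu hx hxu)

/-- The first move of a `K`-local algorithm does not depend on the side on which the strip ends. -/
lemma kNeighborhood_points_succ (hM : 2 * K ≤ M) :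
    kNeighborhood (S.points (M + 1)) K w = kNeighborhood (S.points M) K w := by
  have hadj ⦃N⦄ (hN : 2 * K ≤ N) ⦃x⦄ (hx : x ∈ kNeighborhood (S.points N) K w)
      ⦃y⦄ (hy : y ∈ kNeighborhood (S.points N) K w) :
      (halfTheta6 (S.points (M + 1))).Adj x y ↔ (halfTheta6 (S.points M)).Adj x y := by
    obtain ⟨hx, hxu⟩ := S.mem_points_of_mem_kNeighborhood hN hx
    obtain ⟨hy, hyu⟩ := S.mem_points_of_mem_kNeighborhood hN hy
    exact S.adj_points_succ_iff (S.points_mono hM hx) hxu (S.points_mono hM hy) hyu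
  exact (kNeighborhood_subset_of_adj fun x hx y hy => (hadj (by lia) hx hy).1).antisymm
    (kNeighborhood_subset_of_adj fun x hx y hy => (hadj hM hx hy).2)

end Edges

section Length

variable {i : Fin 3} {u w : Plane} (S : Strip i u w) {A : RoutingAlgorithm} {c K M n : ℕ}

/-- The path has to cross the strip from the side of its second vertex to the side of its
second-to-last vertex `S.point M`. -/
lemma lt_travelled (hc : 1 ≤ c) (hM : 1 ≤ M) (hside : S.side c ≠ S.side M)
    (hA : A w u (kNeighborhood (S.points M) K w) = S.point c)
    (hn : ArrivesAfter A K (S.points M) w u n) :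
    2 * (coord i w - coord i u) + (coord (S.side c) u - coord (S.side c) w) - 4 * S.margin
      < travelled A K (S.points M) w u n := by
  have hwu := ne_of_mem_positiveCone S.apex_mem_positiveCone
  obtain ⟨n, rfl⟩ := Nat.exists_eq_add_of_le' (hn.pos hwu)
  have hfirst : position A K (S.points M) w u 1 = S.point c := hA
  have hlast : position A K (S.points M) w u n = S.point M := by
    have hadj := (hn.2 n (by lia)).2.symm
    rw [hn.1] at hadj
    exact S.eq_point_of_adj_base hM hadj
  have hn1 : 1 ≤ n := by
    rw [Nat.one_le_iff_ne_zero]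
    rintro rfl
    exact ne_of_mem_positiveCone (S.point_mem_positiveCone_apex hM) hlast.symm
  have hlength := dist_add_dist_le_travelled (A := A) (k := K) (P := S.points M) (s := w) (t := u)
    hn1 n.le_succ
  rw [hfirst, hlast, hn.1, dist_comm w] at hlength
  have h := S.distinct c
  have hsum (p : Plane) := coord_add_add_eq_zero h p
  have hMc := S.coord_side_point M
  have hMs := S.coord_side_succ_point M
  rw [S.side_succ_eq hside.symm] at hMs
  rw [← S.side_succ_eq hside] at hMc
  linarith [coord_sub_coord_le_two_mul_dist h (S.point c) w,
    coord_sub_coord_le_two_mul_dist h (S.point c) (S.point M),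
    coord_sub_coord_le_two_mul_dist h.rotate.rotate (S.point M) u,
    hsum u, hsum w, hsum (S.point c), hsum (S.point M), S.coord_side_point c,
    S.coord_side_succ_point c, S.depth_pos hc, S.depth_pos hM, S.depth_lt c, S.depth_lt M]

end Length

end Strip

theorem exists_strip_margin_lt {i : Fin 3} {u w : Plane} (hw : w ∈ positiveCone i u) {ε : ℝ}
    (hε : 0 < ε) : ∃ S : Strip i u w, S.margin < ε := by
  obtain ⟨h1, h2⟩ := (mem_positiveCone (distinct_add i)).1 hw
  obtain ⟨η, hη, hlt⟩ : ∃ η > 0, η < min ε (min ((coord (i + 1) u - coord (i + 1) w) / 2)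
      ((coord (i + 2) u - coord (i + 2) w) / 2)) :=
    exists_between (lt_min hε (lt_min (by linarith) (by linarith)))
  obtain ⟨hηε, hη1, hη2⟩ : η < ε ∧ _ ∧ _ := by simpa only [lt_min_iff] using hlt
  let side (m : ℕ) : Fin 3 := if Even m then i + 1 else i + 2
  let depth (m : ℕ) : ℝ := η - η / (m + 1)
  have hdistinct (m : ℕ) : Distinct i (side m) (side (m + 1)) := by
    by_cases hm : Even m
    · simpa [side, hm, Nat.even_add_one] using distinct_add i
    · simpa [side, hm, Nat.even_add_one] using (distinct_add i).swap
  choose point hpoint using fun m => exists_coord_eq_and_eq (hdistinct m) (coord i w - depth m)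
    (coord (side m) u - (η - depth m) / 2)
  refine ⟨⟨η, side, depth, point, hdistinct, fun m n hmn => ?_, by simp [depth], fun m => ?_,
    fun m => ?_, fun m => (hpoint m).1, fun m => (hpoint m).2⟩, hηε⟩
  · exact sub_lt_sub_left (by gcongr) η
  · exact sub_lt_self η (by positivity)
  · dsimp only [side]
    split_ifs <;> linarith

theorem exists_lt_travelled_of_lt_negativeBound (k : ℕ) (A : RoutingAlgorithm) {i : Fin 3}
    {u w : Plane} (hw : w ∈ positiveCone i u) {L : ℝ} (hL : L < negativeBound i u w) :
    ∃ P : Finset Plane, GeneralPosition P ∧ u ∈ P ∧ w ∈ P ∧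
      ∀ n, ArrivesAfter A k P w u n → L < travelled A k P w u n := by
  obtain ⟨S, hS⟩ := exists_strip_margin_lt hw (ε := (negativeBound i u w - L) / 4) (by linarith)
  have hlong ⦃c M : ℕ⦄ (hc : 1 ≤ c) (hM : 1 ≤ M) (hside : S.side c ≠ S.side M)
      (hA : A w u (kNeighborhood (S.points M) k w) = S.point c) ⦃n : ℕ⦄
      (hn : ArrivesAfter A k (S.points M) w u n) : L < travelled A k (S.points M) w u n := by
    have hmin := min_le_left (coord (S.side c) u - coord (S.side c) w)
      (coord (S.side (c + 1)) u - coord (S.side (c + 1)) w)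
    linarith [S.lt_travelled hc hM hside hA hn, negativeBound_eq (S.distinct c) hw]
  have hN := S.kNeighborhood_points_succ (K := k) (M := 2 * k + 2) (by lia)
  by_cases hA : ∃ c, 1 ≤ c ∧ S.side c = S.side (2 * k + 2) ∧
      A w u (kNeighborhood (S.points (2 * k + 2)) k w) = S.point c
  · obtain ⟨c, hc, hside, hA⟩ := hA
    refine ⟨_, S.generalPosition_points (2 * k + 3), S.base_mem_points, S.apex_mem_points,
      fun n hn => hlong hc (by lia) (hside ▸ (S.distinct _).2.2) (hN ▸ hA) hn⟩
  · refine ⟨_, S.generalPosition_points (2 * k + 2), S.base_mem_points, S.apex_mem_points,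
      fun n hn => ?_⟩
    have hadj := (hn.2 0 (hn.pos (ne_of_mem_positiveCone hw))).2
    obtain ⟨c, hc, -, hA'⟩ := S.exists_point_of_adj_apex (by lia) hadj
    exact hlong hc (by lia) (fun hside => hA ⟨c, hc, hside, hA'.symm⟩) hA'.symm hn

end HalfThetaSix

theorem mainTheorem1 :
    -- a deterministic 1-local 0-memory algorithm that attains both bounds on every instance
    (∃ A : RoutingAlgorithm, ∀ P : Finset Plane, GeneralPosition P →
      ∀ u ∈ P, ∀ w ∈ P, ∀ i : Fin 3, w ∈ positiveCone i u →
        (∃ n : ℕ, ArrivesAfter A 1 P u w n ∧ travelled A 1 P u w n ≤ positiveBound i u w) ∧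
        (∃ n : ℕ, ArrivesAfter A 1 P w u n ∧ travelled A 1 P w u n ≤ negativeBound i u w)) ∧
    -- no k-local 0-memory algorithm does better: for every pair `u`, `w` and every `L` below the
    -- bound, on some instance the message does not arrive within distance `L`
    (∀ (k : ℕ) (A : RoutingAlgorithm) (i : Fin 3) (u w : Plane), w ∈ positiveCone i u →
      (∀ L < positiveBound i u w, ∃ P : Finset Plane, GeneralPosition P ∧ u ∈ P ∧ w ∈ P ∧
        ∀ n : ℕ, ArrivesAfter A k P u w n → L < travelled A k P u w n) ∧
      (∀ L < negativeBound i u w, ∃ P : Finset Plane, GeneralPosition P ∧ u ∈ P ∧ w ∈ P ∧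
        ∀ n : ℕ, ArrivesAfter A k P w u n → L < travelled A k P w u n)) :=
  ⟨⟨router, fun _ hP _ hu _ hw _ h => ⟨router_arrives hP hu hw (.positive h le_rfl),
    router_arrives hP hw hu (.negative h le_rfl)⟩⟩, fun k A _ _ _ h =>
    ⟨fun _ hL => exists_lt_travelled_of_lt_positiveBound k A h hL,
      fun _ hL => exists_lt_travelled_of_lt_negativeBound k A h hL⟩⟩
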